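/- Let $M$ be a complete Riemannian $n$-manifold with Levi-Civita connection $\nabla$ and curvature tensor $R$, let $k\ge 1$ be an integer, and let $\gamma:\mathbb{R}\to M$ be a unit speed geodesic. Write $J'$ for the covariant derivative along $\gamma$ of a vector field $J$ along $\gamma$. We say $Ric_k(\dot\gamma)\ge 0$ (respectively $>0$) if for every $t\in\mathbb{R}$ and every orthonormal $(k+1)$-frame $\{\dot\gamma(t),w_1,\dots,w_k\}$ in $T_{\gamma(t)}M$ one has $\sum_{i=1}^k \sec(\dot\gamma(t),w_i)\ge 0$ (respectively $>0$). Suppose $Ric_k(\dot\gamma)\ge 0$, and let $\Lambda$ be an $(n-1)$-dimensional vector space of Jacobi fields along $\gamma$ (solutions of $J''+R(J,\dot\gamma)\dot\gamma=0$), all pointwise orthogonal to $\dot\gamma$, on which the Riccati operator $S:J\mapsto J'$ is self-adjoint, i.e. $\langle J_1'(t),J_2(t)\rangle=\langle J_1(t),J_2'(t)\rangle$ for all $J_1,J_2\in\Lambda$ and all $t$. Put $$\mathcal{Z}=\mathrm{span}\{J\in\Lambda \mid J(t)=0\text{ for some }t\in\mathbb{R}\},\qquad \mathcal{P}=\{J\in\Lambda\mid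 J\text{ is parallel}\}.$$ 1. If $\dim\mathcal{Z}\le n-k-1$, then $\Lambda$ splits orthogonally as $\Lambda=\mathcal{Z}\oplus\mathcal{P}$; that is, $\Lambda=\mathcal{Z}+\mathcal{P}$, $\mathcal{Z}\cap\mathcal{P}=0$, and $\langle Z(t),P(t)\rangle=0$ for all $Z\in\mathcal{Z}$, $P\in\mathcal{P}$ and $t\in\mathbb{R}$. 2. If moreover $Ric_k(\dot\gamma)>0$ (without assuming the dimension bound of part 1), then $\dim\mathcal{Z}\ge n-k$. -/

import Mathlib

open scoped Manifold ContDiff Bundle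

noncomputable section

namespace JacobiSplitting

section Coordinates

variable {n : ℕ} {M : Type*} [TopologicalSpace M] [ChartedSpace (EuclideanSpace ℝ (Fin n)) M]
  [IsManifold (𝓡 n) ∞ M]

/-- The components of a tangent vector at `x` in the coordinate frame of the chart around `x₀`
(meaningful when `x` lies in the domain of that chart). -/
def coord (x₀ x : M) : TangentSpace (𝓡 n) x →L[ℝ] EuclideanSpace ℝ (Fin n) :=
  (trivializationAt (EuclideanSpace ℝ (Fin n)) (TangentSpace (𝓡 n) : M → Type _) x₀)
    |>.continuousLinearMapAt ℝ x

/-- The tangent vector at `x` with given components in the coordinate frame of the chart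
around `x₀`. -/
def ofCoord (x₀ x : M) : EuclideanSpace ℝ (Fin n) →L[ℝ] TangentSpace (𝓡 n) x :=
  (trivializationAt (EuclideanSpace ℝ (Fin n)) (TangentSpace (𝓡 n) : M → Type _) x₀)
    |>.symmL ℝ x

/-- The partial derivative `∂ᵢ f` at `y`. -/
def partialDeriv (i : Fin n) (f : EuclideanSpace ℝ (Fin n) → ℝ)
    (y : EuclideanSpace ℝ (Fin n)) : ℝ :=
  fderiv ℝ f y (EuclideanSpace.single i 1)

/-- The velocity `γ̇(t)` of a curve. -/
def velocity (n : ℕ) {M : Type*} [TopologicalSpace M]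
    [ChartedSpace (EuclideanSpace ℝ (Fin n)) M] (γ : ℝ → M) (t : ℝ) : TangentSpace (𝓡 n) (γ t) :=
  mfderiv 𝓘(ℝ, ℝ) (𝓡 n) γ t (1 : ℝ)

variable [Bundle.RiemannianBundle (fun x : M => TangentSpace (𝓡 n) x)]

/-- The matrix `(g_ij)` of the Riemannian metric in the chart around `x₀`, as a function of the
coordinates `y`. -/
def metricMatrix (x₀ : M) (y : EuclideanSpace ℝ (Fin n)) : Matrix (Fin n) (Fin n) ℝ :=
  Matrix.of fun i j =>
    inner ℝ
      (ofCoord x₀ ((extChartAt (𝓡 n) x₀).symm y) (EuclideanSpace.single i 1))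
      (ofCoord x₀ ((extChartAt (𝓡 n) x₀).symm y) (EuclideanSpace.single j 1))

/-- The Christoffel symbol `Γ^k_ij` of the Levi-Civita connection in the chart around `x₀`. -/
def christoffel (x₀ : M) (k i j : Fin n) (y : EuclideanSpace ℝ (Fin n)) : ℝ :=
  (1 / 2) * ∑ l, (metricMatrix x₀ y)⁻¹ k l *
    (partialDeriv i (fun z => metricMatrix x₀ z j l) y
      + partialDeriv j (fun z => metricMatrix x₀ z i l) y
      - partialDeriv l (fun z => metricMatrix x₀ z i j) y)

/-- The component along `∂_l` of `R(∂ᵢ, ∂ⱼ)∂_k` in the chart around `x₀`, where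
`R(X, Y)Z = ∇_X ∇_Y Z - ∇_Y ∇_X Z - ∇_[X,Y] Z`. -/
def curvatureCoeff (x₀ : M) (l i j k : Fin n) (y : EuclideanSpace ℝ (Fin n)) : ℝ :=
  partialDeriv i (christoffel x₀ l j k) y - partialDeriv j (christoffel x₀ l i k) y
    + ∑ m, (christoffel x₀ l i m y * christoffel x₀ m j k y
      - christoffel x₀ l j m y * christoffel x₀ m i k y)

/-- The curvature tensor `R(u, v)w` at `x`, computed in the chart around `x₀`. For `x` in the
domain of that chart the value does not depend on `x₀`. -/
def curvature (x₀ x : M) (u v w : TangentSpace (𝓡 n) x) : TangentSpace (𝓡 n) x :=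
  ofCoord x₀ x (WithLp.toLp 2 fun l =>
    ∑ i, ∑ j, ∑ k, curvatureCoeff x₀ l i j k (extChartAt (𝓡 n) x₀ x)
      * coord x₀ x u i * coord x₀ x v j * coord x₀ x w k)

/-- The sectional curvature of the plane spanned by `v` and `w`, computed in the chart
around `x₀`. -/
def sectionalCurvature (x₀ x : M) (v w : TangentSpace (𝓡 n) x) : ℝ :=
  inner ℝ (curvature x₀ x w v v) w / (inner ℝ v v * inner ℝ w w - inner ℝ v w ^ 2)

/-- `W` is the covariant derivative `V'` of the vector field `V` along the curve `γ`: in every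
chart, `W^k = dV^k/dt + Γ^k_ij γ̇^i V^j`. -/
def IsCovDerivAlong (γ : ℝ → M) (V W : ∀ t, TangentSpace (𝓡 n) (γ t)) : Prop :=
  ∀ (x₀ : M) (t : ℝ), γ t ∈ (chartAt (EuclideanSpace ℝ (Fin n)) x₀).source → ∀ k : Fin n,
    HasDerivAt (fun s => coord x₀ (γ s) (V s) k)
      (coord x₀ (γ t) (W t) k - ∑ i, ∑ j, christoffel x₀ k i j (extChartAt (𝓡 n) x₀ (γ t))
        * coord x₀ (γ t) (velocity n γ t) i * coord x₀ (γ t) (V t) j) t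

variable (n) in
/-- `γ : ℝ → M` is a geodesic of unit speed. -/
def IsUnitSpeedGeodesic (γ : ℝ → M) : Prop :=
  ContMDiff 𝓘(ℝ, ℝ) (𝓡 n) ∞ γ ∧ IsCovDerivAlong γ (velocity n γ) 0 ∧
    ∀ t, ‖velocity n γ t‖ = 1

/-- `J` is a Jacobi field along `γ`: `J'' + R(J, γ̇)γ̇ = 0` (the curvature term may be computed in
any chart). -/
def IsJacobiField (γ : ℝ → M) (J : ∀ t, TangentSpace (𝓡 n) (γ t)) : Prop :=
  ∃ W A : ∀ t, TangentSpace (𝓡 n) (γ t), IsCovDerivAlong γ J W ∧ IsCovDerivAlong γ W A ∧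
    ∀ (x₀ : M) (t : ℝ), γ t ∈ (chartAt (EuclideanSpace ℝ (Fin n)) x₀).source →
      A t + curvature x₀ (γ t) (J t) (velocity n γ t) (velocity n γ t) = 0

variable (n) in
/-- `Ric_k(γ̇) ≥ 0`: the sum of sectional curvatures `∑ sec(γ̇(t), wᵢ)` is nonnegative for every
orthonormal `(k+1)`-frame `γ̇(t), w₁, …, w_k`. -/
def RicNonneg (k : ℕ) (γ : ℝ → M) : Prop :=
  ∀ (t : ℝ) (w : Fin k → TangentSpace (𝓡 n) (γ t)),
    Orthonormal ℝ (Fin.cons (velocity n γ t) w : Fin (k + 1) → TangentSpace (𝓡 n) (γ t)) →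
    ∀ x₀ : M, γ t ∈ (chartAt (EuclideanSpace ℝ (Fin n)) x₀).source →
      0 ≤ ∑ i, sectionalCurvature x₀ (γ t) (velocity n γ t) (w i)

variable (n) in
/-- `Ric_k(γ̇) > 0`. -/
def RicPos (k : ℕ) (γ : ℝ → M) : Prop :=
  ∀ (t : ℝ) (w : Fin k → TangentSpace (𝓡 n) (γ t)),
    Orthonormal ℝ (Fin.cons (velocity n γ t) w : Fin (k + 1) → TangentSpace (𝓡 n) (γ t)) →
    ∀ x₀ : M, γ t ∈ (chartAt (EuclideanSpace ℝ (Fin n)) x₀).source →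
      0 < ∑ i, sectionalCurvature x₀ (γ t) (velocity n γ t) (w i)

/-- The Riccati operator `S : J ↦ J'` is self-adjoint on `Λ`: `⟨J₁', J₂⟩ = ⟨J₁, J₂'⟩` at all
times. -/
def RiccatiSelfAdjoint (γ : ℝ → M) (Λ : Submodule ℝ (∀ t, TangentSpace (𝓡 n) (γ t))) : Prop :=
  ∀ J₁ ∈ Λ, ∀ J₂ ∈ Λ, ∀ W₁ W₂ : ∀ t, TangentSpace (𝓡 n) (γ t),
    IsCovDerivAlong γ J₁ W₁ → IsCovDerivAlong γ J₂ W₂ →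
    ∀ t, inner ℝ (W₁ t) (J₂ t) = inner ℝ (J₁ t) (W₂ t)

/-- The span of the fields in `Λ` that vanish at some time. -/
def vanishingSpan (γ : ℝ → M) (Λ : Submodule ℝ (∀ t, TangentSpace (𝓡 n) (γ t))) :
    Submodule ℝ (∀ t, TangentSpace (𝓡 n) (γ t)) :=
  Submodule.span ℝ {J | J ∈ Λ ∧ ∃ t, J t = 0}

/-- The space of parallel vector fields along `γ`. -/
def parallelFields (γ : ℝ → M) : Submodule ℝ (∀ t, TangentSpace (𝓡 n) (γ t)) where
  carrier := {V | IsCovDerivAlong γ V 0}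
  zero_mem' := by
    intro x₀ t _ k
    simpa using hasDerivAt_const t (0 : ℝ)
  add_mem' := by
    intro V W hV hW x₀ t ht k
    have h := (hV x₀ t ht k).add (hW x₀ t ht k)
    refine (h.congr_deriv ?_).congr_of_eventuallyEq (.of_forall fun s => ?_)
    · simp [mul_add, Finset.sum_add_distrib]
      ring
    · simp
  smul_mem' := by
    intro c V hV x₀ t ht k
    have h := (hV x₀ t ht k).const_mul c
    refine (h.congr_deriv ?_).congr_of_eventuallyEq (.of_forall fun s => ?_)
    · simp [Finset.mul_sum, mul_left_comm]
    · simp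

end Coordinates

end JacobiSplitting

end

/-!
Let `m` be the codimension of `𝒵` in `Λ`. At each `t` the vertical space
`{Z(t) | Z ∈ 𝒵} + {Z'(t) | Z ∈ 𝒵, Z(t) = 0}` has dimension `dim 𝒵`, and a complement of `𝒵` in `Λ`
projects onto its orthogonal complement. Let `f` be the `m`-th root of the volume of this
projection. It is continuous, and it is positive on all of `ℝ` because every field of `Λ` that
vanishes somewhere lies in `𝒵`. The transverse Riccati equation `S' + S² + Rʰ + 3 A A* = 0`, with
`A` the O'Neill tensor and `Rʰ` the horizontal part of `R(·, γ')γ'`, the Cauchy–Schwarz inequality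
`(tr S)² ≤ m tr S²` and `Ric_k ≥ 0`, applicable as soon as `m ≥ k`, make `f` concave in the barrier
sense. A positive concave function on `ℝ` is constant, so all these inequalities are equalities:
`S`, `A` and `tr Rʰ` vanish, the horizontal components of the fields in `Λ` are parallel and
annihilated by `R(·, γ')γ'`, and so they are themselves parallel Jacobi fields of `Λ`. If
`Ric_k > 0`, then `tr Rʰ` is positive, which rules out `m ≥ k`.
-/

namespace JacobiSplitting

open Filter Topology

section RealAnalysis

lemma eq_zero_of_eventually_norm_deriv_le {E : Type*} [NormedAddCommGroup E] [NormedSpace ℝ E]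
    {f f' : ℝ → E} (hf : ∀ t, HasDerivAt f (f' t) t)
    (hbound : ∀ t₀, ∃ C, ∀ᶠ t in 𝓝 t₀, ‖f' t‖ ≤ C * ‖f t‖) {t₀ : ℝ} (h0 : f t₀ = 0) :
    f = 0 := by
  have hcont : Continuous f := continuous_iff_continuousAt.2 fun t => (hf t).continuousAt
  have hclosed : IsClosed {t | f t = 0} := isClosed_eq hcont continuous_const
  have hopen : IsOpen {t | f t = 0} := by
    refine isOpen_iff_mem_nhds.2 fun a ha => ?_
    obtain ⟨C, hC⟩ := hbound a
    obtain ⟨ε, hε, hball⟩ := Metric.eventually_nhds_iff_ball.1 hC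
    refine mem_of_superset (Metric.ball_mem_nhds a hε) fun b hb => ?_
    have hsub : ∀ t ∈ Set.uIcc a b, t ∈ Metric.ball a ε := fun t ht =>
      (convex_ball a ε).ordConnected.uIcc_subset (Metric.mem_ball_self hε) hb ht
    rcases le_total a b with hab | hab
    · refine eq_zero_of_abs_deriv_le_mul_abs_self_of_eq_zero_right (f' := f') (K := C)
        hcont.continuousOn (fun t _ => (hf t).hasDerivWithinAt) ha (fun t ht => ?_) b ⟨hab, le_rfl⟩
      exact hball t (hsub t (Set.Icc_subset_uIcc (Set.Ico_subset_Icc_self ht)))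
    · have hneg : ∀ t, HasDerivAt (fun s => f (-s)) (-f' (-t)) t := fun t => by
        simpa [Function.comp_def] using (hf (-t)).scomp t (hasDerivAt_neg t)
      have := eq_zero_of_abs_deriv_le_mul_abs_self_of_eq_zero_right (K := C) (a := -a) (b := -b)
        (hcont.comp continuous_neg).continuousOn (fun t _ => (hneg t).hasDerivWithinAt)
        (by simpa using ha) (fun t ht => ?_) (-b) ⟨neg_le_neg hab, le_rfl⟩
      · simpa using this
      · rw [norm_neg]
        exact hball _ (hsub _ (Set.Icc_subset_uIcc' ⟨le_neg.1 ht.2.le, neg_le.1 ht.1⟩))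
  have huniv : {t | f t = 0} = Set.univ := IsClopen.eq_univ ⟨hclosed, hopen⟩ ⟨t₀, h0⟩
  exact funext fun t => huniv.ge (Set.mem_univ t)

lemma tendsto_div_sq_of_hasDerivAt {f f' : ℝ → ℝ} {t₀ d : ℝ}
    (hf : ∀ᶠ t in 𝓝 t₀, HasDerivAt f (f' t) t) (hf' : HasDerivAt f' d t₀)
    (h0 : f t₀ = 0) (h0' : f' t₀ = 0) :
    Tendsto (fun t => f t / (t - t₀) ^ 2) (𝓝[≠] t₀) (𝓝 (d / 2)) := by
  have hg : ∀ t : ℝ, HasDerivAt (fun t => (t - t₀) ^ 2) (2 * (t - t₀)) t := fun t => by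
    simpa using ((hasDerivAt_id t).sub_const t₀).fun_pow 2
  refine HasDerivAt.lhopital_zero_nhdsNE (nhdsWithin_le_nhds hf) (.of_forall hg) ?_ ?_ ?_ ?_
  · filter_upwards [self_mem_nhdsWithin] with t ht
    simpa [sub_eq_zero] using ht
  · simpa [h0] using hf.self_of_nhds.continuousAt.tendsto.mono_left
      (nhdsWithin_le_nhds (s := {t₀}ᶜ))
  · simpa using (hg t₀).continuousAt.tendsto.mono_left (nhdsWithin_le_nhds (s := {t₀}ᶜ))
  · refine ((hasDerivAt_iff_tendsto_slope.1 hf').div_const 2).congr fun t => ?_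
    rw [slope_def_field, h0', sub_zero, div_div, mul_comm]

lemma nonneg_of_isLocalMin_of_hasDerivAt {f f' : ℝ → ℝ} {t₀ d : ℝ}
    (hf : ∀ᶠ t in 𝓝 t₀, HasDerivAt f (f' t) t) (hf' : HasDerivAt f' d t₀)
    (hmin : IsLocalMin f t₀) : 0 ≤ d := by
  have h := tendsto_div_sq_of_hasDerivAt (f := fun t => f t - f t₀)
    (hf.mono fun t ht => ht.sub_const _) hf' (sub_self _)
    (hmin.hasDerivAt_eq_zero hf.self_of_nhds)
  have : 0 ≤ d / 2 := by
    refine ge_of_tendsto h (nhdsWithin_le_nhds ?_)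
    filter_upwards [hmin] with t ht
    exact div_nonneg (sub_nonneg.2 ht) (sq_nonneg _)
  linarith

/-- `u` is touched from above at `t₀` by a twice differentiable function with second derivative
`d` at `t₀`; this is a one-sided bound `u''(t₀) ≤ d` in the barrier sense. -/
def HasUpperSupportAt (u : ℝ → ℝ) (d t₀ : ℝ) : Prop :=
  ∃ φ φ' : ℝ → ℝ, (∀ᶠ t in 𝓝 t₀, HasDerivAt φ (φ' t) t) ∧ HasDerivAt φ' d t₀ ∧
    φ t₀ = u t₀ ∧ ∀ᶠ t in 𝓝 t₀, u t ≤ φ t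

lemma HasUpperSupportAt.add {u g g' : ℝ → ℝ} {d e t₀ : ℝ} (hu : HasUpperSupportAt u d t₀)
    (hg : ∀ᶠ t in 𝓝 t₀, HasDerivAt g (g' t) t) (hg' : HasDerivAt g' e t₀) :
    HasUpperSupportAt (fun t => u t + g t) (d + e) t₀ := by
  obtain ⟨φ, φ', hφ, hφ', h0, hle⟩ := hu
  refine ⟨fun t => φ t + g t, fun t => φ' t + g' t, ?_, hφ'.add hg', by simp only [h0], ?_⟩
  · filter_upwards [hφ, hg] with t h1 h2 using h1.add h2
  · filter_upwards [hle] with t h using by gcongr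

lemma HasUpperSupportAt.add_quadratic {u : ℝ → ℝ} {d t₀ : ℝ} (hu : HasUpperSupportAt u d t₀)
    (p q r a : ℝ) :
    HasUpperSupportAt (fun t => u t + (p + q * (t - a) + r * (t - a) ^ 2)) (d + 2 * r) t₀ := by
  have hlin : ∀ t, HasDerivAt (fun t : ℝ => t - a) 1 t := fun t => (hasDerivAt_id t).sub_const a
  refine hu.add (g' := fun t => q + 2 * r * (t - a)) (.of_forall fun t => ?_) ?_
  · refine ((((hlin t).const_mul q).const_add p).add (((hlin t).fun_pow 2).const_mul r)).congr_deriv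
      ?_
    norm_num
    ring
  · simpa using ((hlin t₀).const_mul (2 * r)).const_add q

lemma HasUpperSupportAt.nonneg_of_isLocalMin {u : ℝ → ℝ} {d t₀ : ℝ}
    (hu : HasUpperSupportAt u d t₀) (hmin : IsLocalMin u t₀) : 0 ≤ d := by
  obtain ⟨φ, φ', hφ, hφ', h0, hle⟩ := hu
  refine nonneg_of_isLocalMin_of_hasDerivAt hφ hφ' ?_
  filter_upwards [hle, hmin] with t h1 h2 using h0 ▸ h2.trans h1

lemma hasUpperSupportAt_mul_exp {u l l' : ℝ → ℝ} {d t₀ : ℝ}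
    (hl : ∀ᶠ t in 𝓝 t₀, HasDerivAt l (l' t) t) (hl' : HasDerivAt l' d t₀) (h0 : l t₀ = 0)
    (hle : ∀ᶠ t in 𝓝 t₀, u t ≤ u t₀ * Real.exp (l t)) :
    HasUpperSupportAt u (u t₀ * (d + l' t₀ ^ 2)) t₀ := by
  refine ⟨fun t => u t₀ * Real.exp (l t), fun t => u t₀ * (Real.exp (l t) * l' t), ?_, ?_,
    by simp [h0], hle⟩
  · filter_upwards [hl] with t ht using ht.exp.const_mul _
  · refine ((hl.self_of_nhds.exp.mul hl').const_mul _).congr_deriv ?_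
    simp only [h0, Real.exp_zero]
    ring

lemma nonneg_of_hasUpperSupportAt_neg {w : ℝ → ℝ} {a b c : ℝ} (hw : ContinuousOn w (Set.Icc a b))
    (hsupp : ∀ t ∈ Set.Ioo a b, ∃ d < 0, HasUpperSupportAt w d t) (ha : 0 ≤ w a) (hb : 0 ≤ w b)
    (hc : c ∈ Set.Icc a b) : 0 ≤ w c := by
  obtain ⟨m, hm, hmin⟩ := isCompact_Icc.exists_isMinOn ⟨c, hc⟩ hw
  suffices h : 0 ≤ w m from h.trans (hmin hc)
  rcases eq_or_lt_of_le hm.1 with rfl | ham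
  · exact ha
  rcases eq_or_lt_of_le hm.2 with rfl | hmb
  · exact hb
  obtain ⟨d, hd, hsupp⟩ := hsupp m ⟨ham, hmb⟩
  exact absurd (hsupp.nonneg_of_isLocalMin (hmin.isLocalMin (Icc_mem_nhds ham hmb))) hd.not_ge

lemma chord_le_of_hasUpperSupportAt {u : ℝ → ℝ} (hu : Continuous u)
    (hsupp : ∀ t, ∃ d ≤ 0, HasUpperSupportAt u d t) {a b c : ℝ} (hac : a < c) (hcb : c < b) :
    u a * (b - c) + u b * (c - a) ≤ u c * (b - a) := by
  have hba : 0 < b - a := sub_pos.2 (hac.trans hcb)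
  obtain ⟨β, hβb⟩ : ∃ β, β * (b - a) = u b - u a := ⟨_, div_mul_cancel₀ _ hba.ne'⟩
  have hperturbed : ∀ ε > 0, u a + β * (c - a) ≤ u c + ε * ((c - a) * (b - c)) := by
    intro ε hε
    have h : 0 ≤ u c + (-u a + (ε * (b - a) - β) * (c - a) + -ε * (c - a) ^ 2) := by
      refine nonneg_of_hasUpperSupportAt_neg
        (w := fun t => u t + (-u a + (ε * (b - a) - β) * (t - a) + -ε * (t - a) ^ 2))
        (Continuous.continuousOn (by fun_prop)) (fun t _ => ?_) ?_ ?_ ⟨hac.le, hcb.le⟩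
      · obtain ⟨d, hd, h⟩ := hsupp t
        exact ⟨_, by linarith, h.add_quadratic (-u a) (ε * (b - a) - β) (-ε) a⟩
      · simp
      · linear_combination hβb
    linear_combination h
  have hchord : u a + β * (c - a) ≤ u c := by
    refine le_of_forall_pos_le_add fun δ hδ => ?_
    have hp : 0 < (c - a) * (b - c) := mul_pos (sub_pos.2 hac) (sub_pos.2 hcb)
    simpa [div_mul_cancel₀ _ hp.ne'] using hperturbed _ (div_pos hδ hp)
  linear_combination (b - a) * hchord + (a - c) * hβb

lemma concaveOn_univ_of_hasUpperSupportAt {u : ℝ → ℝ} (hu : Continuous u)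
    (hsupp : ∀ t, ∃ d ≤ 0, HasUpperSupportAt u d t) : ConcaveOn ℝ Set.univ u := by
  refine concaveOn_of_slope_anti_adjacent convex_univ fun {a c b} _ _ hac hcb => ?_
  have h := chord_le_of_hasUpperSupportAt hu hsupp hac hcb
  rw [div_le_div_iff₀ (sub_pos.2 hcb) (sub_pos.2 hac)]
  linarith

lemma eq_of_concaveOn_univ_of_nonneg {E : Type*} [AddCommGroup E] [Module ℝ E] {u : E → ℝ}
    (hu : ConcaveOn ℝ Set.univ u) (hnonneg : ∀ x, 0 ≤ u x) (x y : E) : u x = u y := by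
  suffices h : ∀ x y, u x ≤ u y from le_antisymm (h x y) (h y x)
  intro x y
  have hscaled : ∀ s ∈ Set.Ioc (0 : ℝ) 1, (1 - s) * u x ≤ u y := by
    intro s hs
    -- `y` lies between `x` and the far away point `z = x + s⁻¹ (y - x)`
    have h := hu.2 (Set.mem_univ x) (Set.mem_univ (x + s⁻¹ • (y - x))) (sub_nonneg.2 hs.2) hs.1.le
      (sub_add_cancel 1 s)
    have hy : (1 - s) • x + s • (x + s⁻¹ • (y - x)) = y := by
      rw [smul_add, smul_inv_smul₀ hs.1.ne']
      module
    rw [hy] at h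
    exact (le_add_of_nonneg_right (mul_nonneg hs.1.le (hnonneg _))).trans h
  have hlim : Tendsto (fun s : ℝ => (1 - s) * u x) (𝓝[>] 0) (𝓝 ((1 - 0) * u x)) :=
    (Continuous.tendsto (by fun_prop) 0).mono_left nhdsWithin_le_nhds
  rw [sub_zero, one_mul] at hlim
  exact le_of_tendsto hlim (mem_of_superset (Ioc_mem_nhdsGT one_pos) hscaled)

end RealAnalysis

section LinearAlgebra

lemma exists_injective_mul_sum_le {k m : ℕ} (hkm : k ≤ m) (a : Fin m → ℝ) :
    ∃ f : Fin k → Fin m, Function.Injective f ∧ m * ∑ i, a (f i) ≤ k * ∑ j, a j := by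
  rcases Nat.eq_zero_or_pos m with rfl | hm
  · exact ⟨Fin.castLE hkm, Fin.castLE_injective hkm, by simp⟩
  have : NeZero m := ⟨hm.ne'⟩
  let shift : Fin m → Fin k → Fin m := fun s i => Fin.castLE hkm i + s
  have hsum : ∑ s, m * ∑ i, a (shift s i) = ∑ _s : Fin m, k * ∑ j, a j := by
    have hrow : ∀ i : Fin k, ∑ s, a (shift s i) = ∑ j, a j := fun i =>
      Equiv.sum_comp (Equiv.addLeft (Fin.castLE hkm i)) a
    rw [← Finset.mul_sum, Finset.sum_comm]
    simp [hrow]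
  obtain ⟨s, -, hs⟩ := Finset.exists_le_of_sum_le Finset.univ_nonempty hsum.le
  exact ⟨shift s, fun i j hij => Fin.castLE_injective hkm (add_right_cancel hij), hs⟩

lemma det_gram_le_prod_norm_sq {E : Type*} [NormedAddCommGroup E] [InnerProductSpace ℝ E]
    {m : ℕ} (v : Fin m → E) : (Matrix.gram ℝ v).det ≤ ∏ i, ‖v i‖ ^ 2 := by
  by_cases hv : LinearIndependent ℝ v
  · let S := Submodule.span ℝ (Set.range v)
    have : FiniteDimensional ℝ S := FiniteDimensional.span_of_finite ℝ (Set.finite_range v)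
    have hS : Module.finrank ℝ S = m := by simpa using finrank_span_eq_card hv
    have : Fact (Module.finrank ℝ S = m) := ⟨hS⟩
    let b : OrthonormalBasis (Fin m) ℝ S := (stdOrthonormalBasis ℝ S).reindex (finCongr hS)
    let w : Fin m → S := fun i => ⟨v i, Submodule.subset_span ⟨i, rfl⟩⟩
    have hgram : (Matrix.gram ℝ w).det = |b.toBasis.orientation.volumeForm w| ^ 2 := by
      rw [Matrix.gram_eq_conjTranspose_mul b w, Matrix.det_mul, Matrix.det_conjTranspose,
        b.toBasis.orientation.volumeForm_robust' b w, Module.Basis.det_apply, sq_abs, sq,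
        star_trivial]
      rfl
    calc (Matrix.gram ℝ v).det = |b.toBasis.orientation.volumeForm w| ^ 2 := hgram
      _ ≤ (∏ i, ‖w i‖) ^ 2 :=
        pow_le_pow_left₀ (abs_nonneg _) (b.toBasis.orientation.abs_volumeForm_apply_le w) 2
      _ = ∏ i, ‖v i‖ ^ 2 := (Finset.prod_pow ..).symm
  · have : (Matrix.gram ℝ v).det = 0 :=
      not_not.1 fun h => hv (Matrix.linearIndependent_of_det_gram_ne_zero h)
    rw [this]
    positivity

end LinearAlgebra

section NearlyOrthonormal

variable {E : Type*} [NormedAddCommGroup E] [InnerProductSpace ℝ E] {ι : Type*} [Fintype ι]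
  [DecidableEq ι]

/-- The Gram matrix of `v` differs from the identity by at most `1 / (2 (card ι + 1))` in each
entry; being an open condition on the Gram matrix, this holds near an orthonormal family and
still controls norms by inner products. -/
def NearlyOrthonormal (v : ι → E) : Prop :=
  ∀ i j, |inner ℝ (v i) (v j) - if i = j then 1 else 0| ≤ 1 / (2 * (Fintype.card ι + 1))

namespace NearlyOrthonormal

variable {v : ι → E}

lemma abs_coeff_le (hv : NearlyOrthonormal v) (c : ι → ℝ) (i : ι) :
    |c i| ≤ |inner ℝ (v i) (∑ j, c j • v j)| + 1 / (2 * (Fintype.card ι + 1)) * ∑ j, |c j| := by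
  have hi : c i = inner ℝ (v i) (∑ j, c j • v j)
      - ∑ j, c j * (inner ℝ (v i) (v j) - if i = j then 1 else 0) := by
    simp [inner_sum, real_inner_smul_right, mul_sub, Finset.sum_sub_distrib]
  calc |c i| ≤ |inner ℝ (v i) (∑ j, c j • v j)|
        + |∑ j, c j * (inner ℝ (v i) (v j) - if i = j then 1 else 0)| := by
        conv_lhs => rw [hi]
        exact abs_sub _ _
    _ ≤ _ := by
        rw [Finset.mul_sum]
        gcongr
        refine (Finset.abs_sum_le_sum_abs _ _).trans (Finset.sum_le_sum fun j _ => ?_)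
        rw [abs_mul, mul_comm]
        exact mul_le_mul_of_nonneg_right (hv i j) (abs_nonneg _)

lemma sum_abs_le (hv : NearlyOrthonormal v) (c : ι → ℝ) :
    ∑ i, |c i| ≤ 2 * ∑ i, |inner ℝ (v i) (∑ j, c j • v j)| := by
  have hsum := Finset.sum_le_sum fun i (_ : i ∈ Finset.univ) => hv.abs_coeff_le c i
  rw [Finset.sum_add_distrib, Finset.sum_const, Finset.card_univ, nsmul_eq_mul, ← mul_assoc]
    at hsum
  have hhalf : (Fintype.card ι : ℝ) * (1 / (2 * (Fintype.card ι + 1))) ≤ 1 / 2 := by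
    rw [mul_one_div, div_le_div_iff₀ (by positivity) (by positivity)]
    linarith
  have := mul_le_mul_of_nonneg_right hhalf
    (Finset.sum_nonneg fun i (_ : i ∈ Finset.univ) => abs_nonneg (c i))
  linarith

lemma linearIndependent (hv : NearlyOrthonormal v) : LinearIndependent ℝ v := by
  rw [Fintype.linearIndependent_iff]
  intro c hc i
  have h := hv.sum_abs_le c
  simp only [hc, inner_zero_right, abs_zero, Finset.sum_const_zero, mul_zero] at h
  have hi := Finset.single_le_sum (f := fun i => |c i|) (fun j _ => abs_nonneg _)
    (Finset.mem_univ i)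
  exact abs_eq_zero.1 (le_antisymm (hi.trans h) (abs_nonneg _))

lemma norm_apply_le_two (hv : NearlyOrthonormal v) (i : ι) : ‖v i‖ ≤ 2 := by
  have h := hv i i
  rw [if_pos rfl, real_inner_self_eq_norm_sq] at h
  have hone : (1 : ℝ) / (2 * (Fintype.card ι + 1)) ≤ 1 := by
    rw [div_le_one (by positivity)]
    linarith [(Fintype.card ι).cast_nonneg (α := ℝ)]
  nlinarith [norm_nonneg (v i), (le_abs_self _).trans (h.trans hone)]

lemma norm_le_of_mem_span (hv : NearlyOrthonormal v) {x : E}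
    (hx : x ∈ Submodule.span ℝ (Set.range v)) : ‖x‖ ≤ 4 * ∑ i, |inner ℝ (v i) x| := by
  obtain ⟨c, rfl⟩ := (Submodule.mem_span_range_iff_exists_fun ℝ).1 hx
  calc ‖∑ j, c j • v j‖ ≤ ∑ j, |c j| * 2 := by
        refine (norm_sum_le _ _).trans (Finset.sum_le_sum fun j _ => ?_)
        rw [norm_smul, Real.norm_eq_abs]
        exact mul_le_mul_of_nonneg_left (hv.norm_apply_le_two j) (abs_nonneg _)
    _ ≤ _ := by
        rw [← Finset.sum_mul]
        linarith [hv.sum_abs_le c]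

lemma norm_starProjection_le (hv : NearlyOrthonormal v) {K : Submodule ℝ E}
    [K.HasOrthogonalProjection] (hK : Submodule.span ℝ (Set.range v) = K) (x : E) :
    ‖K.starProjection x‖ ≤ 4 * ∑ i, |inner ℝ (v i) x| := by
  refine (hv.norm_le_of_mem_span (hK.ge (K.starProjection_apply_mem x))).trans_eq ?_
  congr! 3 with i
  have hi : v i ∈ K := hK.le (Submodule.subset_span ⟨i, rfl⟩)
  rw [← Submodule.inner_starProjection_left_eq_right, Submodule.starProjection_eq_self_iff.2 hi]

end NearlyOrthonormal

end NearlyOrthonormal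

/-- An abstract space `L` of Jacobi fields with self-adjoint Riccati operator: `ev t J` stands for
`J(t)`, `dv t J` for the covariant derivative `J'(t)`, and `R t` for the curvature operator
`R(·, γ'(t))γ'(t)`. The tangent spaces along the geodesic are an arbitrary family `E`, so
the Jacobi equation is stated through inner products of fields. -/
structure LagrangianFamily (L : Type*) [AddCommGroup L] [Module ℝ L] (E : ℝ → Type*)
    [∀ t, NormedAddCommGroup (E t)] [∀ t, InnerProductSpace ℝ (E t)] where
  ev : ∀ t, L →ₗ[ℝ] E t
  dv : ∀ t, L →ₗ[ℝ] E t
  R : ∀ t, E t → E t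
  hasDerivAt_ev : ∀ a b t, HasDerivAt (fun s => inner ℝ (ev s a) (ev s b))
    (inner ℝ (dv t a) (ev t b) + inner ℝ (ev t a) (dv t b)) t
  hasDerivAt_dv : ∀ a b t, HasDerivAt (fun s => inner ℝ (dv s a) (ev s b))
    (-inner ℝ (R t (ev t a)) (ev t b) + inner ℝ (dv t a) (dv t b)) t
  symm : ∀ a b t, inner ℝ (dv t a) (ev t b) = inner ℝ (ev t a) (dv t b)
  eq_zero : ∀ a t, ev t a = 0 → dv t a = 0 → a = 0

namespace LagrangianFamily

variable {L : Type*} [AddCommGroup L] [Module ℝ L] {E : ℝ → Type*}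
  [∀ t, NormedAddCommGroup (E t)] [∀ t, InnerProductSpace ℝ (E t)] {F : LagrangianFamily L E}

lemma inner_dv_ev_eq_zero {l : L} {t : ℝ} (h : F.ev t l = 0) (a : L) :
    inner ℝ (F.dv t l) (F.ev t a) = 0 := by
  rw [F.symm, h, inner_zero_left]

lemma hasDerivAt_inner_ev (a b : L) (t : ℝ) :
    HasDerivAt (fun s => inner ℝ (F.ev s a) (F.ev s b)) (2 * inner ℝ (F.dv t a) (F.ev t b)) t :=
  (F.hasDerivAt_ev a b t).congr_deriv (by rw [F.symm a b]; ring)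

lemma inner_R_comm (F : LagrangianFamily L E) (a b : L) (t : ℝ) :
    inner ℝ (F.R t (F.ev t a)) (F.ev t b) = inner ℝ (F.ev t a) (F.R t (F.ev t b)) := by
  have hswap := (F.hasDerivAt_dv b a t).congr_of_eventuallyEq
    (.of_forall fun s => (F.symm a b s).trans (real_inner_comm _ _))
  have hunique := (F.hasDerivAt_dv a b t).unique hswap
  rw [real_inner_comm (F.dv t a), real_inner_comm (F.ev t a)] at hunique
  linarith

lemma tendsto_inner_ev_div {l : L} {t₀ : ℝ} (h : F.ev t₀ l = 0) (a : L) :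
    Tendsto (fun t => inner ℝ (F.ev t l) (F.ev t a) / (t - t₀)) (𝓝[≠] t₀) (𝓝 0) := by
  have hderiv := hasDerivAt_inner_ev (F := F) l a t₀
  rw [inner_dv_ev_eq_zero h, mul_zero] at hderiv
  refine (hasDerivAt_iff_tendsto_slope.1 hderiv).congr fun t => ?_
  rw [slope_def_field, h, inner_zero_left, sub_zero]

lemma tendsto_inner_ev_div_sq {l : L} {t₀ : ℝ} (h : F.ev t₀ l = 0) (a : L) :
    Tendsto (fun t => inner ℝ (F.ev t l) (F.ev t a) / (t - t₀) ^ 2) (𝓝[≠] t₀)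
      (𝓝 (inner ℝ (F.dv t₀ l) (F.dv t₀ a))) := by
  have hderiv : ∀ t, HasDerivAt (fun s => inner ℝ (F.ev s l) (F.ev s a))
      (2 * inner ℝ (F.dv t a) (F.ev t l)) t := fun t =>
    (hasDerivAt_inner_ev l a t).congr_deriv (by rw [F.symm l a, real_inner_comm])
  convert tendsto_div_sq_of_hasDerivAt (.of_forall hderiv)
    ((F.hasDerivAt_dv a l t₀).const_mul 2) (by simp [h]) (by simp [h]) using 2
  rw [h, inner_zero_right, real_inner_comm]
  ring

section Vertical

/-- The vertical space at time `t` of a space `U` of fields: the values at `t` of the fields in `U`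
and the derivatives at `t` of those vanishing there. Unlike the space of values, it has
the dimension of `U` at all times. -/
def vert (F : LagrangianFamily L E) (U : Submodule ℝ L) (t : ℝ) : Submodule ℝ (E t) :=
  U.map (F.ev t) ⊔ (U ⊓ LinearMap.ker (F.ev t)).map (F.dv t)

variable {U : Submodule ℝ L} {t : ℝ}

lemma ev_mem_vert {a : L} (ha : a ∈ U) (t : ℝ) : F.ev t a ∈ F.vert U t :=
  Submodule.mem_sup_left (Submodule.mem_map_of_mem ha)

lemma dv_mem_vert {a : L} (ha : a ∈ U) (h : F.ev t a = 0) : F.dv t a ∈ F.vert U t :=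
  Submodule.mem_sup_right (Submodule.mem_map_of_mem ⟨ha, h⟩)

lemma vert_le {G : Submodule ℝ (E t)} (hev : ∀ a ∈ U, F.ev t a ∈ G)
    (hdv : ∀ a ∈ U, F.ev t a = 0 → F.dv t a ∈ G) : F.vert U t ≤ G :=
  sup_le (Submodule.map_le_iff_le_comap.2 hev)
    (Submodule.map_le_iff_le_comap.2 fun a ha => hdv a ha.1 ha.2)

lemma exists_of_mem_vert {x : E t} (hx : x ∈ F.vert U t) :
    ∃ a ∈ U, ∃ l ∈ U, F.ev t l = 0 ∧ F.ev t a + F.dv t l = x := by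
  obtain ⟨_, ⟨a, ha, rfl⟩, _, ⟨l, ⟨hl, hl0⟩, rfl⟩, hx⟩ := Submodule.mem_sup.1 hx
  exact ⟨a, ha, l, hl, hl0, hx⟩

lemma inner_eq_zero_of_mem_map_ev_of_mem_map_dv {x y : E t} (hx : x ∈ U.map (F.ev t))
    (hy : y ∈ (U ⊓ LinearMap.ker (F.ev t)).map (F.dv t)) : inner ℝ x y = 0 := by
  obtain ⟨a, -, rfl⟩ := hx
  obtain ⟨l, ⟨-, hl⟩, rfl⟩ := hy
  rw [real_inner_comm, inner_dv_ev_eq_zero hl]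

variable [FiniteDimensional ℝ L]

instance finiteDimensional_vert : FiniteDimensional ℝ (F.vert U t) := by
  unfold vert
  infer_instance

lemma finrank_map_ev_add (F : LagrangianFamily L E) (U : Submodule ℝ L) (t : ℝ) :
    Module.finrank ℝ (U.map (F.ev t)) +
      Module.finrank ℝ (U ⊓ LinearMap.ker (F.ev t) : Submodule ℝ L) = Module.finrank ℝ U := by
  have h := LinearMap.finrank_range_add_finrank_ker ((F.ev t).domRestrict U)
  rw [LinearMap.range_domRestrict, LinearMap.ker_domRestrict] at h
  rw [← h, ← Submodule.map_comap_subtype, Submodule.finrank_map_subtype_eq]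

lemma finrank_vert (F : LagrangianFamily L E) (U : Submodule ℝ L) (t : ℝ) :
    Module.finrank ℝ (F.vert U t) = Module.finrank ℝ U := by
  have hker : Module.finrank ℝ ((U ⊓ LinearMap.ker (F.ev t)).map (F.dv t)) =
      Module.finrank ℝ (U ⊓ LinearMap.ker (F.ev t) : Submodule ℝ L) := by
    rw [← LinearMap.range_domRestrict]
    refine LinearMap.finrank_range_of_inj (LinearMap.ker_eq_bot.1 (LinearMap.ker_eq_bot'.2 ?_))
    rintro ⟨a, ha⟩ h
    exact Subtype.ext (F.eq_zero a t ha.2 h)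
  have hinf : U.map (F.ev t) ⊓ (U ⊓ LinearMap.ker (F.ev t)).map (F.dv t) = ⊥ :=
    disjoint_iff.1 <| Submodule.disjoint_def.2 fun x hx hx' =>
      (inner_self_eq_zero (𝕜 := ℝ)).1 (inner_eq_zero_of_mem_map_ev_of_mem_map_dv hx hx')
  have h := Submodule.finrank_sup_add_finrank_inf_eq (U.map (F.ev t))
    ((U ⊓ LinearMap.ker (F.ev t)).map (F.dv t))
  rw [hinf, finrank_bot, add_zero, hker, finrank_map_ev_add] at h
  exact h

end Vertical

section Frame

variable {t₀ : ℝ} {ι κ : Type*} {l : ι → L} {k : κ → L}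

/-- The vectors `l i (t) / (t - t₀)`, extended to `t = t₀` by `(l i)' (t₀)`, together with
`k j (t)`. -/
noncomputable def frame (F : LagrangianFamily L E) (t₀ : ℝ) (l : ι → L) (k : κ → L) (t : ℝ) :
    ι ⊕ κ → E t :=
  Sum.elim (fun i => if t = t₀ then F.dv t (l i) else (t - t₀)⁻¹ • F.ev t (l i))
    fun j => F.ev t (k j)

lemma frame_inl_self (i : ι) : F.frame t₀ l k t₀ (.inl i) = F.dv t₀ (l i) := by simp [frame]

lemma frame_inl_of_ne {t : ℝ} (h : t ≠ t₀) (i : ι) :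
    F.frame t₀ l k t (.inl i) = (t - t₀)⁻¹ • F.ev t (l i) := by simp [frame, h]

lemma frame_inr (t : ℝ) (j : κ) : F.frame t₀ l k t (.inr j) = F.ev t (k j) := rfl

lemma continuousAt_inner_frame_ev (hl : ∀ i, F.ev t₀ (l i) = 0) (a : L) (i : ι ⊕ κ) :
    ContinuousAt (fun t => inner ℝ (F.frame t₀ l k t i) (F.ev t a)) t₀ := by
  rcases i with i | j
  · rw [continuousAt_iff_punctured_nhds, frame_inl_self, inner_dv_ev_eq_zero (hl i)]
    refine (tendsto_inner_ev_div (hl i) a).congr' ?_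
    filter_upwards [self_mem_nhdsWithin] with t ht
    rw [frame_inl_of_ne ht, real_inner_smul_left, div_eq_inv_mul]
  · exact (hasDerivAt_inner_ev (k j) a t₀).continuousAt

lemma continuousAt_inner_frame (hl : ∀ i, F.ev t₀ (l i) = 0) (i j : ι ⊕ κ) :
    ContinuousAt (fun t => inner ℝ (F.frame t₀ l k t i) (F.frame t₀ l k t j)) t₀ := by
  rcases j with j | j
  · rcases i with i | i
    · rw [continuousAt_iff_punctured_nhds, frame_inl_self, frame_inl_self]
      refine (tendsto_inner_ev_div_sq (hl i) (l j)).congr' ?_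
      filter_upwards [self_mem_nhdsWithin] with t ht
      rw [frame_inl_of_ne ht, frame_inl_of_ne ht, real_inner_smul_left, real_inner_smul_right,
        div_eq_inv_mul, sq, mul_inv, mul_assoc]
    · simp only [frame_inr, real_inner_comm _ (F.ev _ (k i))]
      exact continuousAt_inner_frame_ev hl (k i) (.inl j)
  · exact continuousAt_inner_frame_ev hl (k j) i

lemma hasDerivAt_inner_frame_ev (hl : ∀ i, F.ev t₀ (l i) = 0) {q : L} (hq : F.dv t₀ q = 0)
    (i : ι ⊕ κ) : HasDerivAt (fun t => inner ℝ (F.frame t₀ l k t i) (F.ev t q)) 0 t₀ := by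
  rcases i with i | j
  · rw [hasDerivAt_iff_tendsto_slope]
    have h := tendsto_inner_ev_div_sq (hl i) q
    rw [hq, inner_zero_right] at h
    refine h.congr' ?_
    filter_upwards [self_mem_nhdsWithin] with t ht
    rw [slope_def_field, frame_inl_self, inner_dv_ev_eq_zero (hl i), sub_zero, frame_inl_of_ne ht,
      real_inner_smul_left, ← div_eq_inv_mul, div_div, sq]
  · exact (hasDerivAt_inner_ev (k j) q t₀).congr_deriv
      (by rw [F.symm, hq, inner_zero_right, mul_zero])

lemma eventually_nearlyOrthonormal_frame [Fintype ι] [Fintype κ] [DecidableEq ι] [DecidableEq κ]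
    (hl : ∀ i, F.ev t₀ (l i) = 0) (ho : Orthonormal ℝ (F.frame t₀ l k t₀)) :
    ∀ᶠ t in 𝓝 t₀, NearlyOrthonormal (F.frame t₀ l k t) := by
  unfold NearlyOrthonormal
  simp only [eventually_all]
  intro i j
  have hlim : Tendsto (fun t => |inner ℝ (F.frame t₀ l k t i) (F.frame t₀ l k t j)
      - if i = j then (1 : ℝ) else 0|) (𝓝 t₀) (𝓝 0) := by
    have := ((continuousAt_inner_frame (k := k) hl i j).tendsto.sub_const
      (if i = j then (1 : ℝ) else 0)).abs
    rwa [orthonormal_iff_ite.1 ho i j, sub_self, abs_zero] at this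
  exact (hlim.eventually_lt tendsto_const_nhds (by positivity)).mono fun t ht => ht.le

/-- The fields `l` and `k` in `U`, the former vanishing at `t₀`, give an orthonormal basis
`F.frame t₀ l k t₀` of the vertical space of `U` at `t₀`. -/
structure IsVerticalFrame (F : LagrangianFamily L E) (U : Submodule ℝ L) (t₀ : ℝ) (l : ι → L)
    (k : κ → L) : Prop where
  left_mem : ∀ i, l i ∈ U
  ev_left : ∀ i, F.ev t₀ (l i) = 0
  right_mem : ∀ j, k j ∈ U
  orthonormal : Orthonormal ℝ (F.frame t₀ l k t₀)
  span_eq : Submodule.span ℝ (Set.range (F.frame t₀ l k t₀)) = F.vert U t₀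

lemma exists_isVerticalFrame (F : LagrangianFamily L E) [FiniteDimensional ℝ L]
    (U : Submodule ℝ L) (t₀ : ℝ) :
    ∃ (p d : ℕ) (l : Fin p → L) (k : Fin d → L), F.IsVerticalFrame U t₀ l k := by
  let A := stdOrthonormalBasis ℝ ((U ⊓ LinearMap.ker (F.ev t₀)).map (F.dv t₀))
  let B := stdOrthonormalBasis ℝ (U.map (F.ev t₀))
  choose l hlU hlA using fun i => Submodule.mem_map.1 (A i).2
  choose k hkU hkB using fun j => Submodule.mem_map.1 (B j).2
  have hframe : F.frame t₀ l k t₀ = Sum.elim (fun i => (A i : E t₀)) fun j => (B j : E t₀) := by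
    ext (i | j)
    · rw [frame_inl_self, hlA, Sum.elim_inl]
    · rw [frame_inr, hkB, Sum.elim_inr]
  refine ⟨_, _, l, k, fun i => (hlU i).1, fun i => (hlU i).2, hkU, ?_, ?_⟩
  · rw [hframe, orthonormal_iff_ite]
    rintro (i | i) (j | j)
    · simpa using orthonormal_iff_ite.1 A.orthonormal i j
    · simpa [real_inner_comm] using inner_eq_zero_of_mem_map_ev_of_mem_map_dv (B j).2 (A i).2
    · simpa using inner_eq_zero_of_mem_map_ev_of_mem_map_dv (B i).2 (A j).2
    · simpa using orthonormal_iff_ite.1 B.orthonormal i j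
  · have hspan {G : Submodule ℝ (E t₀)} {n : ℕ} (b : OrthonormalBasis (Fin n) ℝ G) :
        Submodule.span ℝ (Set.range fun i => (b i : E t₀)) = G := by
      change Submodule.span ℝ (Set.range (G.subtype ∘ b)) = G
      rw [Set.range_comp, Submodule.span_image, ← b.coe_toBasis, b.toBasis.span_eq,
        Submodule.map_subtype_top]
    rw [hframe, Set.Sum.elim_range, Submodule.span_union, hspan, hspan, sup_comm, vert]

namespace IsVerticalFrame

variable [Fintype ι] [Fintype κ] {U : Submodule ℝ L} [FiniteDimensional ℝ L]

lemma card_eq_finrank (h : F.IsVerticalFrame U t₀ l k) :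
    Fintype.card (ι ⊕ κ) = Module.finrank ℝ U := by
  rw [← F.finrank_vert U t₀, ← h.span_eq, finrank_span_eq_card h.orthonormal.linearIndependent]

variable [DecidableEq ι] [DecidableEq κ]

lemma span_eq_map_ev (h : F.IsVerticalFrame U t₀ l k) {t : ℝ} (ht : t ≠ t₀)
    (hn : NearlyOrthonormal (F.frame t₀ l k t)) :
    Submodule.span ℝ (Set.range (F.frame t₀ l k t)) = U.map (F.ev t) := by
  refine Submodule.eq_of_le_of_finrank_le (Submodule.span_le.2 ?_) ?_
  · rintro _ ⟨i | j, rfl⟩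
    · rw [frame_inl_of_ne ht]
      exact Submodule.smul_mem _ _ (Submodule.mem_map_of_mem (h.left_mem i))
    · exact Submodule.mem_map_of_mem (h.right_mem j)
  · rw [finrank_span_eq_card hn.linearIndependent, h.card_eq_finrank]
    exact Submodule.finrank_map_le _ _

lemma inf_ker_ev_eq_bot (h : F.IsVerticalFrame U t₀ l k) {t : ℝ} (ht : t ≠ t₀)
    (hn : NearlyOrthonormal (F.frame t₀ l k t)) : U ⊓ LinearMap.ker (F.ev t) = ⊥ := by
  have hadd := finrank_map_ev_add F U t
  rw [← h.span_eq_map_ev ht hn, finrank_span_eq_card hn.linearIndependent, h.card_eq_finrank]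
    at hadd
  exact Submodule.finrank_eq_zero.1 (by omega)

lemma span_eq_vert (h : F.IsVerticalFrame U t₀ l k) {t : ℝ}
    (hn : NearlyOrthonormal (F.frame t₀ l k t)) :
    Submodule.span ℝ (Set.range (F.frame t₀ l k t)) = F.vert U t := by
  rcases eq_or_ne t t₀ with rfl | ht
  · exact h.span_eq
  · rw [h.span_eq_map_ev ht hn, vert, h.inf_ker_ev_eq_bot ht hn, Submodule.map_bot, sup_bot_eq]

end IsVerticalFrame

lemma eventually_ev_injective (F : LagrangianFamily L E) [FiniteDimensional ℝ L] (t₀ : ℝ) :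
    ∀ᶠ t in 𝓝[≠] t₀, Function.Injective (F.ev t) := by
  obtain ⟨p, d, l, k, h⟩ := F.exists_isVerticalFrame ⊤ t₀
  filter_upwards [nhdsWithin_le_nhds (eventually_nearlyOrthonormal_frame h.ev_left h.orthonormal),
    self_mem_nhdsWithin] with t hn ht
  exact LinearMap.ker_eq_bot.1 (top_inf_eq (LinearMap.ker (F.ev t)) ▸ h.inf_ker_ev_eq_bot ht hn)

end Frame

section Horizontal

variable [FiniteDimensional ℝ L] {U : Submodule ℝ L}

/-- The horizontal component of `J(t)`, that is, its component orthogonal to the vertical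
space of `U`. -/
noncomputable def hor (F : LagrangianFamily L E) (U : Submodule ℝ L) (t : ℝ) : L →ₗ[ℝ] E t :=
  (F.vert U t)ᗮ.starProjection.toLinearMap ∘ₗ F.ev t

lemma hor_apply (t : ℝ) (a : L) : F.hor U t a = (F.vert U t)ᗮ.starProjection (F.ev t a) := rfl

lemma hor_eq_of_sub_mem {a b : L} (h : a - b ∈ U) (t : ℝ) : F.hor U t a = F.hor U t b := by
  rw [← sub_eq_zero, ← map_sub, hor_apply]
  exact Submodule.starProjection_orthogonal_apply_eq_zero (ev_mem_vert h t)

lemma hor_eq_ev {a : L} {t : ℝ} (h : F.ev t a ∈ (F.vert U t)ᗮ) : F.hor U t a = F.ev t a :=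
  Submodule.starProjection_eq_self_iff.2 h

lemma norm_hor_le (t : ℝ) (a : L) : ‖F.hor U t a‖ ≤ ‖F.ev t a‖ :=
  Submodule.norm_starProjection_apply_le _ _

lemma inner_hor (t : ℝ) (a b : L) :
    inner ℝ (F.hor U t a) (F.hor U t b) = inner ℝ (F.ev t a) (F.ev t b)
      - inner ℝ ((F.vert U t).starProjection (F.ev t a))
        ((F.vert U t).starProjection (F.ev t b)) := by
  rw [hor_apply, hor_apply, Submodule.inner_starProjection_left_eq_right,
    Submodule.inner_starProjection_left_eq_right,
    Submodule.starProjection_eq_self_iff.2 (Submodule.starProjection_apply_mem _ _),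
    Submodule.starProjection_eq_self_iff.2 (Submodule.starProjection_apply_mem _ _),
    ← inner_sub_right, Submodule.starProjection_orthogonal_val]

lemma exists_eventually_norm_starProjection_le (F : LagrangianFamily L E) (U : Submodule ℝ L)
    (t₀ : ℝ) : ∃ (p d : ℕ) (l : Fin p → L) (k : Fin d → L), F.IsVerticalFrame U t₀ l k ∧
      ∀ q, ∀ᶠ t in 𝓝 t₀, ‖(F.vert U t).starProjection (F.ev t q)‖ ≤
        4 * ∑ i, |inner ℝ (F.frame t₀ l k t i) (F.ev t q)| := by
  obtain ⟨p, d, l, k, h⟩ := F.exists_isVerticalFrame U t₀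
  refine ⟨p, d, l, k, h, fun q => ?_⟩
  filter_upwards [eventually_nearlyOrthonormal_frame h.ev_left h.orthonormal] with t hn
  exact hn.norm_starProjection_le (h.span_eq_vert hn) _

omit [FiniteDimensional ℝ L] in
lemma IsVerticalFrame.inner_frame_self {ι κ : Type*} {t₀ : ℝ} {l : ι → L} {k : κ → L}
    (h : F.IsVerticalFrame U t₀ l k) {q : L} (hq : F.ev t₀ q ∈ (F.vert U t₀)ᗮ) (i : ι ⊕ κ) :
    inner ℝ (F.frame t₀ l k t₀ i) (F.ev t₀ q) = 0 :=
  Submodule.inner_right_of_mem_orthogonal (h.span_eq.le (Submodule.subset_span ⟨i, rfl⟩)) hq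

lemma tendsto_norm_starProjection_ev {t₀ : ℝ} {q : L} (hq : F.ev t₀ q ∈ (F.vert U t₀)ᗮ) :
    Tendsto (fun t => ‖(F.vert U t).starProjection (F.ev t q)‖) (𝓝 t₀) (𝓝 0) := by
  obtain ⟨p, d, l, k, h, hle⟩ := F.exists_eventually_norm_starProjection_le U t₀
  refine squeeze_zero' (.of_forall fun t => norm_nonneg _) (hle q) ?_
  have := (tendsto_finsetSum Finset.univ fun i _ =>
    (continuousAt_inner_frame_ev (k := k) h.ev_left q i).abs.tendsto).const_mul 4
  simpa [h.inner_frame_self hq] using this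

lemma isLittleO_norm_starProjection_ev {t₀ : ℝ} {q : L} (hq : F.ev t₀ q ∈ (F.vert U t₀)ᗮ)
    (hdq : F.dv t₀ q = 0) :
    (fun t => ‖(F.vert U t).starProjection (F.ev t q)‖) =o[𝓝 t₀] fun t => t - t₀ := by
  obtain ⟨p, d, l, k, h, hle⟩ := F.exists_eventually_norm_starProjection_le U t₀
  have hframe : ∀ i, (fun t => inner ℝ (F.frame t₀ l k t i) (F.ev t q)) =o[𝓝 t₀]
      fun t => t - t₀ := fun i => by
    simpa [h.inner_frame_self hq i] using
      hasDerivAt_iff_isLittleO.1 (hasDerivAt_inner_frame_ev (k := k) h.ev_left hdq i)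
  have hsum : (fun t => 4 * ∑ i, |inner ℝ (F.frame t₀ l k t i) (F.ev t q)|) =o[𝓝 t₀]
      fun t => t - t₀ :=
    (Asymptotics.IsLittleO.fun_sum fun i _ => (hframe i).abs_left).const_mul_left 4
  refine Asymptotics.IsBigO.trans_isLittleO (.of_bound' ?_) hsum
  filter_upwards [hle q] with t ht
  rw [norm_norm]
  exact ht.trans (le_abs_self _)

lemma exists_ev_eq_starProjection {t : ℝ} {x : E t}
    (hx : ∀ l ∈ U, F.ev t l = 0 → inner ℝ (F.dv t l) x = 0) :
    ∃ z ∈ U, F.ev t z = (F.vert U t).starProjection x := by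
  obtain ⟨z, hz, l, hl, hl0, hzl⟩ :=
    exists_of_mem_vert ((F.vert U t).starProjection_apply_mem x)
  have hdl : F.dv t l = 0 := by
    have h := Submodule.inner_right_of_mem_orthogonal (dv_mem_vert hl hl0)
      ((F.vert U t).sub_starProjection_mem_orthogonal x)
    rwa [← hzl, inner_sub_right, inner_add_right, inner_dv_ev_eq_zero hl0, hx l hl hl0, zero_add,
      zero_sub, neg_eq_zero, inner_self_eq_zero] at h
  exact ⟨z, hz, by rw [← hzl, hdl, add_zero]⟩

/-- The fields which are the optimal representatives at time `t` of their classes modulo `U`: both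
their values and their derivatives have no avoidable component along `U`. They represent
the quotient of the family by `U` at time `t`. -/
noncomputable def lifts (F : LagrangianFamily L E) (U : Submodule ℝ L) (t : ℝ) : Submodule ℝ L :=
  (F.vert U t)ᗮ.comap (F.ev t) ⊓ ((U ⊓ LinearMap.ker (F.ev t)).map (F.dv t))ᗮ.comap (F.dv t)

omit [FiniteDimensional ℝ L] in
lemma inner_dv_dv_of_mem_lifts {t : ℝ} {q l : L} (hq : q ∈ F.lifts U t) (hl : l ∈ U)
    (h0 : F.ev t l = 0) : inner ℝ (F.dv t l) (F.dv t q) = 0 := by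
  have hlU : l ∈ U ⊓ LinearMap.ker (F.ev t) := ⟨hl, h0⟩
  exact Submodule.inner_right_of_mem_orthogonal (Submodule.mem_map_of_mem hlU) hq.2

lemma exists_sub_mem_lifts (F : LagrangianFamily L E) (U : Submodule ℝ L) (a : L) (t : ℝ) :
    ∃ z ∈ U, a - z ∈ F.lifts U t := by
  obtain ⟨z, hz, hza⟩ := exists_ev_eq_starProjection (F := F) (U := U) (x := F.ev t a)
    fun l _ hl => inner_dv_ev_eq_zero hl a
  obtain ⟨l, ⟨hlU, hl0⟩, hl⟩ := Submodule.mem_map.1 (Submodule.starProjection_apply_mem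
    ((U ⊓ LinearMap.ker (F.ev t)).map (F.dv t)) (F.dv t (a - z)))
  have hl0 : F.ev t l = 0 := hl0
  refine ⟨z + l, U.add_mem hz hlU, ?_, ?_⟩
  · change F.ev t (a - (z + l)) ∈ (F.vert U t)ᗮ
    rw [map_sub, map_add, hza, hl0, add_zero]
    exact Submodule.sub_starProjection_mem_orthogonal _
  · change F.dv t (a - (z + l)) ∈ ((U ⊓ LinearMap.ker (F.ev t)).map (F.dv t))ᗮ
    rw [← sub_sub, map_sub, hl]
    exact Submodule.sub_starProjection_mem_orthogonal _

lemma isCompl_lifts (F : LagrangianFamily L E) (U : Submodule ℝ L) (t : ℝ) :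
    IsCompl U (F.lifts U t) := by
  constructor
  · refine Submodule.disjoint_def.2 fun a haU ha => ?_
    have hev : F.ev t a = 0 := (inner_self_eq_zero (𝕜 := ℝ)).1
      (Submodule.inner_right_of_mem_orthogonal (ev_mem_vert haU t) ha.1)
    exact F.eq_zero a t hev ((inner_self_eq_zero (𝕜 := ℝ)).1 (inner_dv_dv_of_mem_lifts ha haU hev))
  · refine codisjoint_iff.2 (eq_top_iff.2 fun a _ => ?_)
    obtain ⟨z, hz, ha⟩ := F.exists_sub_mem_lifts U a t
    exact Submodule.mem_sup.2 ⟨z, hz, a - z, ha, by abel⟩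

lemma continuous_inner_hor (F : LagrangianFamily L E) (U : Submodule ℝ L) (a b : L) :
    Continuous fun t => inner ℝ (F.hor U t a) (F.hor U t b) := by
  refine continuous_iff_continuousAt.2 fun t₀ => ?_
  obtain ⟨z, hz, hza, -⟩ := F.exists_sub_mem_lifts U a t₀
  obtain ⟨w, hw, hwb, -⟩ := F.exists_sub_mem_lifts U b t₀
  have hproj : Tendsto (fun t => inner ℝ ((F.vert U t).starProjection (F.ev t (a - z)))
      ((F.vert U t).starProjection (F.ev t (b - w)))) (𝓝 t₀) (𝓝 0) := by
    have h := (tendsto_norm_starProjection_ev hza).mul (tendsto_norm_starProjection_ev hwb)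
    rw [mul_zero] at h
    exact squeeze_zero_norm (fun t => norm_inner_le_norm _ _) h
  have hlim := (hasDerivAt_inner_ev (F := F) (a - z) (b - w) t₀).continuousAt.tendsto.sub hproj
  have ha : ∀ t, F.hor U t a = F.hor U t (a - z) := hor_eq_of_sub_mem (by simpa using hz)
  have hb : ∀ t, F.hor U t b = F.hor U t (b - w) := hor_eq_of_sub_mem (by simpa using hw)
  unfold ContinuousAt
  simp only [ha, hb]
  rw [hor_eq_ev hza, hor_eq_ev hwb]
  simpa only [inner_hor, sub_zero] using hlim

end Horizontal

section Riccati

variable {Z : Submodule ℝ L} {t : ℝ}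

/-- The values at time `t` of the fields in `F.lifts Z t`. -/
noncomputable def horizontal (F : LagrangianFamily L E) (Z : Submodule ℝ L) (t : ℝ) :
    Submodule ℝ (E t) :=
  LinearMap.range ((F.ev t).domRestrict (F.lifts Z t))

lemma mem_orthogonal_of_mem_horizontal {x : E t} (hx : x ∈ F.horizontal Z t) :
    x ∈ (F.vert Z t)ᗮ := by
  obtain ⟨q, rfl⟩ := hx
  exact q.2.1

variable [FiniteDimensional ℝ L] (hZ : ∀ a, F.ev t a = 0 → a ∈ Z)

instance finiteDimensional_horizontal : FiniteDimensional ℝ (F.horizontal Z t) := by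
  unfold horizontal
  infer_instance

include hZ in
lemma injective_ev_domRestrict_lifts :
    Function.Injective ((F.ev t).domRestrict (F.lifts Z t)) :=
  LinearMap.ker_eq_bot.1 (LinearMap.ker_eq_bot'.2 fun q hq => Subtype.ext <|
    Submodule.disjoint_def.1 (F.isCompl_lifts Z t).disjoint q (hZ q hq) q.2)

/-- Evaluation at time `t` on the fields in `F.lifts Z t`, when all fields vanishing at `t` lie in
`Z`. -/
noncomputable def liftsEquiv : F.lifts Z t ≃ₗ[ℝ] F.horizontal Z t :=
  LinearEquiv.ofInjective _ (injective_ev_domRestrict_lifts hZ)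

lemma ev_liftsEquiv_symm (x : F.horizontal Z t) : F.ev t ((liftsEquiv hZ).symm x) = x :=
  congrArg Subtype.val ((liftsEquiv hZ).apply_symm_apply x)

include hZ in
lemma finrank_add_finrank_horizontal :
    Module.finrank ℝ Z + Module.finrank ℝ (F.horizontal Z t) = Module.finrank ℝ L := by
  rw [← (liftsEquiv hZ).finrank_eq]
  exact Submodule.finrank_add_eq_of_isCompl (F.isCompl_lifts Z t)

include hZ in
lemma vert_top_le : F.vert ⊤ t ≤ F.vert Z t ⊔ F.horizontal Z t := by
  refine vert_le (fun a _ => ?_) fun l _ hl => Submodule.mem_sup_left (dv_mem_vert (hZ l hl) hl)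
  obtain ⟨z, hz, hq⟩ := F.exists_sub_mem_lifts Z a t
  rw [← add_sub_cancel z a, map_add]
  exact Submodule.add_mem_sup (ev_mem_vert hz t) ⟨⟨_, hq⟩, rfl⟩

/-- The transverse Riccati operator `J(t) ↦ J'(t)ʰ` on the horizontal space, where `J` runs over
`F.lifts Z t`. -/
noncomputable def riccati : F.horizontal Z t →ₗ[ℝ] F.horizontal Z t :=
  (F.horizontal Z t).orthogonalProjectionOnto.toLinearMap ∘ₗ F.dv t ∘ₗ
    (F.lifts Z t).subtype ∘ₗ (liftsEquiv hZ).symm.toLinearMap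

lemma inner_riccati (x y : F.horizontal Z t) :
    inner ℝ (riccati hZ x) y = inner ℝ (F.dv t ((liftsEquiv hZ).symm x)) (y : E t) :=
  Submodule.inner_orthogonalProjectionOnto_eq_of_mem_right y _

lemma isSymmetric_riccati : (riccati hZ).IsSymmetric := fun x y => by
  calc inner ℝ (riccati hZ x) y
      = inner ℝ (F.dv t ((liftsEquiv hZ).symm x)) (F.ev t ((liftsEquiv hZ).symm y)) := by
        rw [inner_riccati, ev_liftsEquiv_symm]
    _ = inner ℝ (F.ev t ((liftsEquiv hZ).symm x)) (F.dv t ((liftsEquiv hZ).symm y)) :=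
        F.symm _ _ t
    _ = inner ℝ x (riccati hZ y) := by
        rw [ev_liftsEquiv_symm, real_inner_comm, ← inner_riccati, real_inner_comm]

include hZ in
lemma exists_dv_eq_smul_add {q : L} (hq : q ∈ F.lifts Z t) (hdv : F.dv t q ∈ F.vert ⊤ t) {c : ℝ}
    (hc : ∀ y ∈ F.horizontal Z t, inner ℝ (F.dv t q) y = c * inner ℝ (F.ev t q) y) :
    ∃ z ∈ Z, F.dv t q = c • F.ev t q + F.ev t z := by
  obtain ⟨z, hz, hproj⟩ := exists_ev_eq_starProjection fun l hl hl0 =>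
    inner_dv_dv_of_mem_lifts hq hl hl0
  refine ⟨z, hz, ?_⟩
  set x := F.dv t q - (c • F.ev t q + F.ev t z) with hx
  have htop : x ∈ F.vert Z t ⊔ F.horizontal Z t :=
    vert_top_le hZ (sub_mem hdv (add_mem (Submodule.smul_mem _ _ (ev_mem_vert Submodule.mem_top t))
      (ev_mem_vert Submodule.mem_top t)))
  have hvert : ∀ v ∈ F.vert Z t, inner ℝ v x = 0 := fun v hv => by
    rw [hx, add_comm, ← sub_sub, inner_sub_right, hproj, real_inner_smul_right,
      Submodule.inner_right_of_mem_orthogonal hv (Submodule.sub_starProjection_mem_orthogonal _),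
      Submodule.inner_right_of_mem_orthogonal hv hq.1, mul_zero, sub_zero]
  have hhor : ∀ y ∈ F.horizontal Z t, inner ℝ y x = 0 := fun y hy => by
    rw [real_inner_comm, hx, inner_sub_left, inner_add_left, real_inner_smul_left, hc y hy,
      Submodule.inner_right_of_mem_orthogonal (ev_mem_vert hz t)
        (mem_orthogonal_of_mem_horizontal hy), add_zero, sub_self]
  obtain ⟨v, hv, y, hy, hvy⟩ := Submodule.mem_sup.1 htop
  have hzero : inner ℝ x x = 0 := by
    nth_rw 1 [← hvy]
    rw [inner_add_left, hvert v hv, hhor y hy, add_zero]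
  exact sub_eq_zero.1 (inner_self_eq_zero.1 hzero)

/-- A family of fields `J i` spanning a complement of `Z`, horizontal and orthonormal at time `t`,
which diagonalizes the transverse Riccati operator: the derivative of `J i` is
`lam i • J i + K i`, where the `K i ∈ Z` carry the O'Neill tensor of the splitting into vertical and
horizontal spaces. -/
structure IsEigenframe (F : LagrangianFamily L E) (Z : Submodule ℝ L) (t : ℝ) {m : ℕ}
    (J K : Fin m → L) (lam : Fin m → ℝ) : Prop where
  mem_orthogonal : ∀ i, F.ev t (J i) ∈ (F.vert Z t)ᗮ
  orthonormal : Orthonormal ℝ fun i => F.ev t (J i)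
  mem : ∀ i, K i ∈ Z
  dv_eq : ∀ i, F.dv t (J i) = lam i • F.ev t (J i) + F.ev t (K i)
  span_sup : Submodule.span ℝ (Set.range J) ⊔ Z = ⊤

include hZ in
lemma exists_isEigenframe (hdv : ∀ a, F.dv t a ∈ F.vert ⊤ t) {m : ℕ}
    (hm : Module.finrank ℝ Z + m = Module.finrank ℝ L) :
    ∃ (J K : Fin m → L) (lam : Fin m → ℝ), F.IsEigenframe Z t J K lam := by
  have hdim : Module.finrank ℝ (F.horizontal Z t) = m := by
    have := finrank_add_finrank_horizontal hZ
    omega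
  let b := (isSymmetric_riccati hZ).eigenvectorBasis hdim
  let lam := (isSymmetric_riccati hZ).eigenvalues hdim
  let J : Fin m → L := fun i => (liftsEquiv hZ).symm (b i)
  have hJ : ∀ i, F.ev t (J i) = b i := fun i => ev_liftsEquiv_symm hZ (b i)
  have hriccati : ∀ i, ∀ y ∈ F.horizontal Z t,
      inner ℝ (F.dv t (J i)) y = lam i * inner ℝ (F.ev t (J i)) y := fun i y hy => by
    rw [← inner_riccati hZ (b i) ⟨y, hy⟩, (isSymmetric_riccati hZ).apply_eigenvectorBasis hdim i,
      hJ, real_inner_smul_left]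
    rfl
  choose K hKZ hK using fun i =>
    exists_dv_eq_smul_add hZ ((liftsEquiv hZ).symm (b i)).2 (hdv _) (hriccati i)
  refine ⟨J, K, lam, fun i => ((liftsEquiv hZ).symm (b i)).2.1, ?_, hKZ, hK, ?_⟩
  · simp only [hJ]
    exact b.orthonormal.comp_linearIsometry (F.horizontal Z t).subtypeₗᵢ
  · rw [← (F.isCompl_lifts Z t).symm.sup_eq_top]
    congr 1
    change Submodule.span ℝ (Set.range ((F.lifts Z t).subtype ∘ (liftsEquiv hZ).symm ∘ b)) = _
    rw [Set.range_comp, Submodule.span_image, Set.range_comp, ← LinearEquiv.coe_toLinearMap,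
      Submodule.span_image, ← b.coe_toBasis, b.toBasis.span_eq, Submodule.map_top,
      LinearEquiv.range, Submodule.map_subtype_top]

end Riccati

section Barrier

variable {t₀ : ℝ}

/-- The squared norm of the comparison field `J - (t - t₀) K`. For the fields of an eigenframe it
has the same horizontal component as `J`, and the covariant derivative `lam • J` at `t₀`. -/
noncomputable def barrier (F : LagrangianFamily L E) (t₀ : ℝ) (J K : L) (t : ℝ) : ℝ :=
  ‖F.ev t (J - (t - t₀) • K)‖ ^ 2

/-- The derivative of `barrier`, simplified by self-adjointness of the Riccati operator. -/
noncomputable def barrierDeriv (F : LagrangianFamily L E) (t₀ : ℝ) (J K : L) (t : ℝ) : ℝ :=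
  2 * inner ℝ (F.dv t J) (F.ev t J) - 2 * inner ℝ (F.ev t J) (F.ev t K)
    - 4 * ((t - t₀) * inner ℝ (F.dv t J) (F.ev t K))
    + 2 * ((t - t₀) * inner ℝ (F.ev t K) (F.ev t K))
    + 2 * ((t - t₀) ^ 2 * inner ℝ (F.dv t K) (F.ev t K))

lemma barrier_eq (J K : L) (t : ℝ) : F.barrier t₀ J K t = inner ℝ (F.ev t J) (F.ev t J)
    - 2 * ((t - t₀) * inner ℝ (F.ev t J) (F.ev t K))
    + (t - t₀) ^ 2 * inner ℝ (F.ev t K) (F.ev t K) := by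
  rw [barrier, ← real_inner_self_eq_norm_sq, map_sub, map_smul]
  simp only [inner_sub_left, inner_sub_right, real_inner_smul_left, real_inner_smul_right,
    real_inner_comm (F.ev t J) (F.ev t K)]
  ring

lemma hasDerivAt_sub_sq (t₀ t : ℝ) : HasDerivAt (fun s => (s - t₀) ^ 2) (2 * (t - t₀)) t := by
  simpa using ((hasDerivAt_id t).sub_const t₀).fun_pow 2

lemma hasDerivAt_barrier (J K : L) (t : ℝ) :
    HasDerivAt (F.barrier t₀ J K) (F.barrierDeriv t₀ J K t) t := by
  have hsub : HasDerivAt (fun s => s - t₀) 1 t := (hasDerivAt_id t).sub_const t₀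
  have h := ((hasDerivAt_inner_ev (F := F) J J t).sub
    ((hsub.mul (hasDerivAt_inner_ev (F := F) J K t)).const_mul 2)).add
    ((hasDerivAt_sub_sq t₀ t).mul (hasDerivAt_inner_ev (F := F) K K t))
  refine (h.congr_deriv ?_).congr_of_eventuallyEq (.of_forall fun s => barrier_eq J K s)
  rw [barrierDeriv]
  ring

lemma hasDerivAt_barrierDeriv (J K : L) :
    HasDerivAt (F.barrierDeriv t₀ J K)
      (2 * (-inner ℝ (F.R t₀ (F.ev t₀ J)) (F.ev t₀ J) + inner ℝ (F.dv t₀ J) (F.dv t₀ J))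
      - 8 * inner ℝ (F.dv t₀ J) (F.ev t₀ K) + 2 * inner ℝ (F.ev t₀ K) (F.ev t₀ K)) t₀ := by
  have hsub : HasDerivAt (fun s => s - t₀) 1 t₀ := (hasDerivAt_id t₀).sub_const t₀
  have h := (((((F.hasDerivAt_dv J J t₀).const_mul 2).sub
    ((hasDerivAt_inner_ev (F := F) J K t₀).const_mul 2)).sub
    ((hsub.mul (F.hasDerivAt_dv J K t₀)).const_mul 4)).add
    ((hsub.mul (hasDerivAt_inner_ev (F := F) K K t₀)).const_mul 2)).add
    (((hasDerivAt_sub_sq t₀ t₀).mul (F.hasDerivAt_dv K K t₀)).const_mul 2)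
  refine h.congr_deriv ?_
  simp only [sub_self]
  ring

namespace IsEigenframe

variable {Z : Submodule ℝ L} {m : ℕ} {J K : Fin m → L} {lam : Fin m → ℝ}

lemma inner_ev_K (h : F.IsEigenframe Z t₀ J K lam) (i : Fin m) :
    inner ℝ (F.ev t₀ (J i)) (F.ev t₀ (K i)) = 0 :=
  Submodule.inner_left_of_mem_orthogonal (ev_mem_vert (h.mem i) t₀) (h.mem_orthogonal i)

lemma inner_self (h : F.IsEigenframe Z t₀ J K lam) (i : Fin m) :
    inner ℝ (F.ev t₀ (J i)) (F.ev t₀ (J i)) = 1 := by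
  rw [real_inner_self_eq_norm_sq, h.orthonormal.1 i, one_pow]

lemma barrier_self (h : F.IsEigenframe Z t₀ J K lam) (i : Fin m) :
    F.barrier t₀ (J i) (K i) t₀ = 1 := by
  simp [barrier, h.orthonormal.1 i]

lemma barrierDeriv_self (h : F.IsEigenframe Z t₀ J K lam) (i : Fin m) :
    F.barrierDeriv t₀ (J i) (K i) t₀ = 2 * lam i := by
  simp only [barrierDeriv, sub_self, h.dv_eq, inner_add_left, real_inner_smul_left, h.inner_self,
    h.inner_ev_K, real_inner_comm (F.ev t₀ (J i)) (F.ev t₀ (K i))]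
  ring

lemma hasDerivAt_barrierDeriv (h : F.IsEigenframe Z t₀ J K lam) (i : Fin m) :
    HasDerivAt (F.barrierDeriv t₀ (J i) (K i))
      (2 * lam i ^ 2 - 2 * inner ℝ (F.R t₀ (F.ev t₀ (J i))) (F.ev t₀ (J i))
      - 4 * ‖F.ev t₀ (K i)‖ ^ 2) t₀ := by
  refine (LagrangianFamily.hasDerivAt_barrierDeriv (J i) (K i)).congr_deriv ?_
  simp only [h.dv_eq, inner_add_left, inner_add_right, real_inner_smul_left, real_inner_smul_right,
    h.inner_self, h.inner_ev_K, real_inner_comm (F.ev t₀ (J i)) (F.ev t₀ (K i)),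
    real_inner_self_eq_norm_sq (F.ev t₀ (K i))]
  ring

lemma eventually_barrier_pos (h : F.IsEigenframe Z t₀ J K lam) :
    ∀ᶠ t in 𝓝 t₀, ∀ i, 0 < F.barrier t₀ (J i) (K i) t := by
  refine eventually_all.2 fun i => (hasDerivAt_barrier (J i) (K i) t₀).continuousAt.eventually
    (lt_mem_nhds ?_)
  rw [h.barrier_self]
  exact one_pos

end IsEigenframe

end Barrier

section LogBarrier

variable {Z : Submodule ℝ L} {m : ℕ} {t₀ : ℝ} {J K : Fin m → L} {lam : Fin m → ℝ}

/-- The trace `∑ᵢ ⟨R(Jᵢ(t), γ')γ', Jᵢ(t)⟩` of the curvature operator over a finite family of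
fields. -/
noncomputable def curvatureSum {ι : Type*} [Fintype ι] (F : LagrangianFamily L E) (t : ℝ)
    (J : ι → L) : ℝ :=
  ∑ i, inner ℝ (F.R t (F.ev t (J i))) (F.ev t (J i))

/-- The trace of `S² + Rʰ + 2 A A*`, where `S` is the transverse Riccati operator, `Rʰ` the
horizontal curvature operator and `A` the O'Neill tensor. The exact Riccati equation has `3 A A*`;
one copy of `A A*` is lost to the vertical part of the comparison fields. -/
noncomputable def riccatiTrace (F : LagrangianFamily L E) (t : ℝ) (J K : Fin m → L)
    (lam : Fin m → ℝ) : ℝ :=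
  ∑ i, lam i ^ 2 + F.curvatureSum t J + 2 * ∑ i, ‖F.ev t (K i)‖ ^ 2

/-- The logarithm of the comparison function for `horRadius`, normalized to vanish at `t₀`. -/
noncomputable def logBarrier (F : LagrangianFamily L E) (t₀ : ℝ) (J K : Fin m → L) (t : ℝ) : ℝ :=
  (2 * m : ℝ)⁻¹ * ∑ i, Real.log (F.barrier t₀ (J i) (K i) t)

/-- The derivative of `logBarrier`. -/
noncomputable def logBarrierDeriv (F : LagrangianFamily L E) (t₀ : ℝ) (J K : Fin m → L)
    (t : ℝ) : ℝ :=
  (2 * m : ℝ)⁻¹ * ∑ i, F.barrierDeriv t₀ (J i) (K i) t / F.barrier t₀ (J i) (K i) t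

lemma exp_logBarrier {t : ℝ} (ht : ∀ i, 0 < F.barrier t₀ (J i) (K i) t) :
    Real.exp (F.logBarrier t₀ J K t) = (∏ i, F.barrier t₀ (J i) (K i) t) ^ (2 * m : ℝ)⁻¹ := by
  rw [Real.rpow_def_of_pos (Finset.prod_pos fun i _ => ht i), Real.log_prod fun i _ => (ht i).ne',
    logBarrier, mul_comm]

namespace IsEigenframe

lemma hasDerivAt_logBarrier (h : F.IsEigenframe Z t₀ J K lam) :
    ∀ᶠ t in 𝓝 t₀, HasDerivAt (F.logBarrier t₀ J K) (F.logBarrierDeriv t₀ J K t) t := by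
  filter_upwards [h.eventually_barrier_pos] with t ht
  exact (HasDerivAt.fun_sum fun i _ =>
    (hasDerivAt_barrier (J i) (K i) t).log (ht i).ne').const_mul _

lemma logBarrier_self (h : F.IsEigenframe Z t₀ J K lam) : F.logBarrier t₀ J K t₀ = 0 := by
  simp [logBarrier, h.barrier_self]

lemma logBarrierDeriv_self (h : F.IsEigenframe Z t₀ J K lam) :
    F.logBarrierDeriv t₀ J K t₀ = (m : ℝ)⁻¹ * ∑ i, lam i := by
  simp only [logBarrierDeriv, h.barrier_self, h.barrierDeriv_self, div_one, ← Finset.mul_sum]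
  rw [mul_inv]
  ring

lemma hasDerivAt_logBarrierDeriv (h : F.IsEigenframe Z t₀ J K lam) :
    HasDerivAt (F.logBarrierDeriv t₀ J K) (-((m : ℝ)⁻¹ * F.riccatiTrace t₀ J K lam)) t₀ := by
  have hd := (HasDerivAt.fun_sum fun i (_ : i ∈ Finset.univ) => (h.hasDerivAt_barrierDeriv i).div
    (hasDerivAt_barrier (F := F) (t₀ := t₀) (J i) (K i) t₀)
    (by rw [h.barrier_self]; exact one_ne_zero)).const_mul (2 * m : ℝ)⁻¹
  refine hd.congr_deriv ?_
  simp only [riccatiTrace, curvatureSum, h.barrier_self, h.barrierDeriv_self, Finset.mul_sum,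
    ← Finset.sum_add_distrib, ← Finset.sum_neg_distrib]
  refine Finset.sum_congr rfl fun i _ => ?_
  rw [mul_inv]
  ring

lemma sq_logBarrierDeriv_le (h : F.IsEigenframe Z t₀ J K lam) (hR : 0 ≤ F.curvatureSum t₀ J) :
    F.logBarrierDeriv t₀ J K t₀ ^ 2 ≤ (m : ℝ)⁻¹ * F.riccatiTrace t₀ J K lam := by
  have hcauchy : (m : ℝ)⁻¹ * (∑ i, lam i) ^ 2 ≤ ∑ i, lam i ^ 2 := by
    refine inv_mul_le_of_le_mul₀ m.cast_nonneg (by positivity) ?_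
    simpa using sq_sum_le_card_mul_sum_sq (s := Finset.univ) (f := lam)
  calc F.logBarrierDeriv t₀ J K t₀ ^ 2 = (m : ℝ)⁻¹ * ((m : ℝ)⁻¹ * (∑ i, lam i) ^ 2) := by
        rw [h.logBarrierDeriv_self]
        ring
    _ ≤ (m : ℝ)⁻¹ * F.riccatiTrace t₀ J K lam := by
        gcongr
        rw [riccatiTrace, add_assoc]
        exact hcauchy.trans (le_add_of_nonneg_right (by positivity))

lemma eq_zero_of_riccatiTrace_nonpos (h : F.IsEigenframe Z t₀ J K lam)
    (htrace : F.riccatiTrace t₀ J K lam ≤ 0) (hR : 0 ≤ F.curvatureSum t₀ J) :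
    (∀ i, F.dv t₀ (J i) = 0) ∧ F.curvatureSum t₀ J = 0 := by
  have hlam : 0 ≤ ∑ i, lam i ^ 2 := Finset.sum_nonneg fun i _ => sq_nonneg _
  have hK : 0 ≤ ∑ i, ‖F.ev t₀ (K i)‖ ^ 2 := Finset.sum_nonneg fun i _ => sq_nonneg _
  rw [riccatiTrace] at htrace
  refine ⟨fun i => ?_, by linarith⟩
  have hlam_i : lam i ^ 2 = 0 := (Finset.sum_eq_zero_iff_of_nonneg fun i _ => sq_nonneg _).1
    (le_antisymm (by linarith) hlam) i (Finset.mem_univ i)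
  have hK_i : ‖F.ev t₀ (K i)‖ ^ 2 = 0 :=
    (Finset.sum_eq_zero_iff_of_nonneg fun i _ => sq_nonneg _).1
      (le_antisymm (by linarith) hK) i (Finset.mem_univ i)
  rw [sq_eq_zero_iff] at hlam_i hK_i
  rw [h.dv_eq, hlam_i, norm_eq_zero.1 hK_i, zero_smul, add_zero]

end IsEigenframe

end LogBarrier

section HorVolume

variable [FiniteDimensional ℝ L] {Z : Submodule ℝ L} {m : ℕ} {c : Fin m → L}

/-- The squared volume of the parallelepiped spanned by the horizontal components of
the fields `c i`. -/
noncomputable def horVolume (F : LagrangianFamily L E) (Z : Submodule ℝ L) (c : Fin m → L)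
    (t : ℝ) : ℝ :=
  (Matrix.gram ℝ fun i => F.hor Z t (c i)).det

lemma continuous_horVolume : Continuous (F.horVolume Z c) :=
  Continuous.matrix_det (continuous_matrix fun i j => F.continuous_inner_hor Z (c i) (c j))

lemma horVolume_nonneg (t : ℝ) : 0 ≤ F.horVolume Z c t :=
  (Matrix.posSemidef_gram ℝ _).det_nonneg

lemma exists_horVolume_eq_mul (hc : Submodule.span ℝ (Set.range c) ⊔ Z = ⊤) (J : Fin m → L) :
    ∃ r, ∀ t, F.horVolume Z J t = r * F.horVolume Z c t := by
  have hcoord : ∀ i, ∃ B : Fin m → ℝ, J i - ∑ j, B j • c j ∈ Z := fun i => by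
    obtain ⟨x, hx, z, hz, hxz⟩ := Submodule.mem_sup.1 (hc.ge (Submodule.mem_top (x := J i)))
    obtain ⟨B, rfl⟩ := (Submodule.mem_span_range_iff_exists_fun ℝ).1 hx
    exact ⟨B, by rwa [← hxz, add_sub_cancel_left]⟩
  choose B hB using hcoord
  have hJ : ∀ t i, F.hor Z t (J i) = ∑ j, B i j • F.hor Z t (c j) := fun t i => by
    rw [hor_eq_of_sub_mem (hB i) t]
    simp
  refine ⟨(Matrix.of B).det ^ 2, fun t => ?_⟩
  have hgram : (Matrix.gram ℝ fun i => F.hor Z t (J i)) =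
      Matrix.of B * (Matrix.gram ℝ fun i => F.hor Z t (c i)) * (Matrix.of B).transpose := by
    ext i j
    simp only [Matrix.gram_apply, hJ, Matrix.mul_apply, Matrix.transpose_apply, Matrix.of_apply,
      sum_inner, inner_sum, real_inner_smul_left, real_inner_smul_right, Finset.sum_mul]
    exact Finset.sum_congr rfl fun a _ => Finset.sum_congr rfl fun b _ => by ring
  rw [horVolume, hgram, Matrix.det_mul, Matrix.det_mul, Matrix.det_transpose, horVolume]
  ring

/-- The `m`-th root of the horizontal volume of the `m` fields `c i`. The exponent is the one for
which the traced Riccati equation and the Cauchy–Schwarz inequality give concavity. -/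
noncomputable def horRadius (F : LagrangianFamily L E) (Z : Submodule ℝ L) (c : Fin m → L)
    (t : ℝ) : ℝ :=
  F.horVolume Z c t ^ (2 * m : ℝ)⁻¹

lemma continuous_horRadius : Continuous (F.horRadius Z c) :=
  continuous_horVolume.rpow_const fun _ => Or.inr (by positivity)

lemma horRadius_nonneg (t : ℝ) : 0 ≤ F.horRadius Z c t :=
  Real.rpow_nonneg (horVolume_nonneg t) _

namespace IsEigenframe

variable {t₀ : ℝ} {J K : Fin m → L} {lam : Fin m → ℝ}

lemma horVolume_self (h : F.IsEigenframe Z t₀ J K lam) : F.horVolume Z J t₀ = 1 := by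
  have : (Matrix.gram ℝ fun i => F.hor Z t₀ (J i)) = 1 := by
    rw [Matrix.gram_eq_one_iff_orthonormal]
    simpa only [hor_eq_ev (h.mem_orthogonal _)] using h.orthonormal
  rw [horVolume, this, Matrix.det_one]

lemma horVolume_le_prod (h : F.IsEigenframe Z t₀ J K lam) (t : ℝ) :
    F.horVolume Z J t ≤ ∏ i, F.barrier t₀ (J i) (K i) t := by
  refine (det_gram_le_prod_norm_sq _).trans (Finset.prod_le_prod (fun i _ => sq_nonneg _)
    fun i _ => pow_le_pow_left₀ (norm_nonneg _) ?_ 2)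
  have hmem : J i - (J i - (t - t₀) • K i) ∈ Z := by
    rw [sub_sub_cancel]
    exact Z.smul_mem _ (h.mem i)
  rw [hor_eq_of_sub_mem hmem t]
  exact norm_hor_le t _

lemma horVolume_eq_mul (h : F.IsEigenframe Z t₀ J K lam)
    (hc : Submodule.span ℝ (Set.range c) ⊔ Z = ⊤) (t : ℝ) :
    F.horVolume Z c t = F.horVolume Z c t₀ * F.horVolume Z J t := by
  obtain ⟨r, hJ⟩ := exists_horVolume_eq_mul (F := F) hc J
  rw [hJ t, ← mul_assoc, mul_comm _ r, ← hJ t₀, h.horVolume_self, one_mul]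

lemma horVolume_pos (h : F.IsEigenframe Z t₀ J K lam)
    (hc : Submodule.span ℝ (Set.range c) ⊔ Z = ⊤) : 0 < F.horVolume Z c t₀ := by
  obtain ⟨r, hJ⟩ := exists_horVolume_eq_mul (F := F) hc J
  refine (horVolume_nonneg t₀).lt_of_ne' fun h0 => one_ne_zero (α := ℝ) ?_
  rw [← h.horVolume_self, hJ t₀, h0, mul_zero]

lemma horRadius_pos (h : F.IsEigenframe Z t₀ J K lam)
    (hc : Submodule.span ℝ (Set.range c) ⊔ Z = ⊤) : 0 < F.horRadius Z c t₀ :=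
  Real.rpow_pos_of_pos (h.horVolume_pos hc) _

lemma horRadius_le (h : F.IsEigenframe Z t₀ J K lam)
    (hc : Submodule.span ℝ (Set.range c) ⊔ Z = ⊤) :
    ∀ᶠ t in 𝓝 t₀, F.horRadius Z c t ≤ F.horRadius Z c t₀ * Real.exp (F.logBarrier t₀ J K t) := by
  filter_upwards [h.eventually_barrier_pos] with t ht
  calc F.horRadius Z c t
      ≤ (F.horVolume Z c t₀ * ∏ i, F.barrier t₀ (J i) (K i) t) ^ (2 * m : ℝ)⁻¹ := by
        refine Real.rpow_le_rpow (horVolume_nonneg t) ?_ (by positivity)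
        rw [h.horVolume_eq_mul hc]
        exact mul_le_mul_of_nonneg_left (h.horVolume_le_prod t) (horVolume_nonneg t₀)
    _ = F.horRadius Z c t₀ * Real.exp (F.logBarrier t₀ J K t) := by
        rw [Real.mul_rpow (horVolume_nonneg t₀) (Finset.prod_nonneg fun i _ => (ht i).le),
          exp_logBarrier ht, horRadius]

lemma hasUpperSupportAt_horRadius (h : F.IsEigenframe Z t₀ J K lam)
    (hc : Submodule.span ℝ (Set.range c) ⊔ Z = ⊤) (hR : 0 ≤ F.curvatureSum t₀ J) :
    ∃ d ≤ 0, HasUpperSupportAt (F.horRadius Z c) d t₀ :=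
  ⟨_, mul_nonpos_of_nonneg_of_nonpos (horRadius_nonneg t₀)
      (neg_add_nonpos_iff.2 (h.sq_logBarrierDeriv_le hR)),
    hasUpperSupportAt_mul_exp h.hasDerivAt_logBarrier h.hasDerivAt_logBarrierDeriv
      h.logBarrier_self (h.horRadius_le hc)⟩

lemma riccatiTrace_nonpos (h : F.IsEigenframe Z t₀ J K lam)
    (hc : Submodule.span ℝ (Set.range c) ⊔ Z = ⊤)
    (hconst : ∀ s t, F.horRadius Z c s = F.horRadius Z c t) (hm : 0 < m) :
    F.riccatiTrace t₀ J K lam ≤ 0 := by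
  have hmin : IsLocalMin (F.logBarrier t₀ J K) t₀ := by
    filter_upwards [h.horRadius_le hc] with t ht
    rw [hconst t t₀, le_mul_iff_one_le_right (h.horRadius_pos hc), Real.one_le_exp_iff] at ht
    rwa [h.logBarrier_self]
  have hd := nonneg_of_isLocalMin_of_hasDerivAt h.hasDerivAt_logBarrier
    h.hasDerivAt_logBarrierDeriv hmin
  rw [neg_nonneg] at hd
  exact nonpos_of_mul_nonpos_right hd (by positivity)

end IsEigenframe

end HorVolume

section Splitting

variable {k : ℕ} {Z : Submodule ℝ L}

/-- Nonnegativity of the sums of `k` curvatures over orthonormal values of fields in the family,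
that is, `Ric_k ≥ 0` on the space spanned by these values. -/
def HasNonnegRicci (F : LagrangianFamily L E) (k : ℕ) : Prop :=
  ∀ t (J : Fin k → L), Orthonormal ℝ (fun i => F.ev t (J i)) → 0 ≤ F.curvatureSum t J

/-- Positivity of the sums of `k` curvatures over orthonormal values of fields in the family. -/
def HasPosRicci (F : LagrangianFamily L E) (k : ℕ) : Prop :=
  ∀ t (J : Fin k → L), Orthonormal ℝ (fun i => F.ev t (J i)) → 0 < F.curvatureSum t J

/-- The derivatives of the fields take values in the space filled by the family at each time, as
for a family of maximal dimension. -/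
def IsMaximal (F : LagrangianFamily L E) : Prop :=
  ∀ t a, F.dv t a ∈ F.vert ⊤ t

lemma HasPosRicci.pos (hF : F.HasPosRicci k) : 0 < k := by
  refine Nat.pos_of_ne_zero ?_
  rintro rfl
  simpa [curvatureSum] using hF 0 0 (by simp [Orthonormal, Pairwise])

lemma HasPosRicci.hasNonnegRicci (hF : F.HasPosRicci k) : F.HasNonnegRicci k :=
  fun t J hJ => (hF t J hJ).le

lemma HasNonnegRicci.mono (hF : F.HasNonnegRicci k) (hk : 1 ≤ k) {m : ℕ} (hkm : k ≤ m) :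
    F.HasNonnegRicci m := fun t J hJ => by
  obtain ⟨f, hf, hle⟩ := exists_injective_mul_sum_le hkm
    fun i => inner ℝ (F.R t (F.ev t (J i))) (F.ev t (J i))
  have hsum := mul_nonneg m.cast_nonneg (hF t (J ∘ f) (hJ.comp f hf))
  exact nonneg_of_mul_nonneg_right (hsum.trans hle) (by exact_mod_cast hk)

lemma HasPosRicci.mono (hF : F.HasPosRicci k) {m : ℕ} (hkm : k ≤ m) :
    F.HasPosRicci m := fun t J hJ => by
  obtain ⟨f, hf, hle⟩ := exists_injective_mul_sum_le hkm
    fun i => inner ℝ (F.R t (F.ev t (J i))) (F.ev t (J i))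
  have hm : (0 : ℝ) < m := by exact_mod_cast hF.pos.trans_le hkm
  have hsum := mul_pos hm (hF t (J ∘ f) (hJ.comp f hf))
  exact pos_of_mul_pos_right (hsum.trans_le hle) k.cast_nonneg

variable [FiniteDimensional ℝ L]

lemma IsMaximal.exists_isEigenframe_dv_eq_zero (hF : F.IsMaximal) {m : ℕ} (hm : 1 ≤ m)
    (hRic : F.HasNonnegRicci m) (hZ : ∀ t a, F.ev t a = 0 → a ∈ Z)
    (hdim : Module.finrank ℝ Z + m = Module.finrank ℝ L) (t : ℝ) :
    ∃ (J K : Fin m → L) (lam : Fin m → ℝ), F.IsEigenframe Z t J K lam ∧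
      (∀ i, F.dv t (J i) = 0) ∧ F.curvatureSum t J = 0 := by
  have hframe := fun t => exists_isEigenframe (hZ t) (hF t) hdim
  obtain ⟨c, _, _, hc⟩ := hframe 0
  have hsupp : ∀ t, ∃ d ≤ 0, HasUpperSupportAt (F.horRadius Z c) d t := fun t => by
    obtain ⟨J, K, lam, h⟩ := hframe t
    exact h.hasUpperSupportAt_horRadius hc.span_sup (hRic t J h.orthonormal)
  have hconst := eq_of_concaveOn_univ_of_nonneg
    (concaveOn_univ_of_hasUpperSupportAt continuous_horRadius hsupp) horRadius_nonneg
  obtain ⟨J, K, lam, h⟩ := hframe t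
  exact ⟨J, K, lam, h, h.eq_zero_of_riccatiTrace_nonpos
    (h.riccatiTrace_nonpos hc.span_sup hconst hm) (hRic t J h.orthonormal)⟩

lemma IsMaximal.exists_horizontal_dv_eq_zero (hF : F.IsMaximal) (hk : 1 ≤ k)
    (hRic : F.HasNonnegRicci k) (hZ : ∀ t a, F.ev t a = 0 → a ∈ Z)
    (hdim : Module.finrank ℝ Z + k ≤ Module.finrank ℝ L) (t : ℝ) (a : L) :
    ∃ q, a - q ∈ Z ∧ F.ev t q ∈ (F.vert Z t)ᗮ ∧ F.dv t q = 0 := by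
  obtain ⟨m, hm⟩ := Nat.exists_eq_add_of_le hdim
  obtain ⟨J, K, lam, h, hdv, -⟩ := hF.exists_isEigenframe_dv_eq_zero (m := k + m) (by omega)
    (hRic.mono hk (Nat.le_add_right k m)) hZ (by omega) t
  obtain ⟨q, hq, z, hz, rfl⟩ := Submodule.mem_sup.1 (h.span_sup.ge (Submodule.mem_top (x := a)))
  have hle : Submodule.span ℝ (Set.range J) ≤
      (F.vert Z t)ᗮ.comap (F.ev t) ⊓ LinearMap.ker (F.dv t) :=
    Submodule.span_le.2 (Set.range_subset_iff.2 fun i => ⟨h.mem_orthogonal i, hdv i⟩)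
  exact ⟨q, by rwa [add_sub_cancel_left], hle hq⟩

lemma IsMaximal.finrank_lt_of_hasPosRicci (hF : F.IsMaximal) (hRic : F.HasPosRicci k)
    (hZ : ∀ t a, F.ev t a = 0 → a ∈ Z) :
    Module.finrank ℝ L < Module.finrank ℝ Z + k := by
  by_contra! hdim
  obtain ⟨m, hm⟩ := Nat.exists_eq_add_of_le hdim
  have hkm : k ≤ k + m := Nat.le_add_right k m
  obtain ⟨J, K, lam, h, -, hflat⟩ := hF.exists_isEigenframe_dv_eq_zero
    (hRic.pos.trans_le hkm) (hRic.hasNonnegRicci.mono hRic.pos hkm) hZ (by omega) 0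
  exact (hRic.mono hkm 0 J h.orthonormal).ne' hflat

end Splitting

end LagrangianFamily

section MatrixCalculus

variable {E : Type*} [NormedAddCommGroup E] [NormedSpace ℝ E] {ι : Type*} [Fintype ι]
  [DecidableEq ι] {s : Set E} {A : E → Matrix ι ι ℝ} {m : WithTop ℕ∞}

lemma contDiffOn_det (hA : ∀ i j, ContDiffOn ℝ m (fun y => A y i j) s) :
    ContDiffOn ℝ m (fun y => (A y).det) s := by
  simp only [Matrix.det_apply]
  exact ContDiffOn.sum fun σ _ => (contDiffOn_prod fun i _ => hA _ _).const_smul _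

lemma contDiffOn_inv_apply (hA : ∀ i j, ContDiffOn ℝ m (fun y => A y i j) s)
    (hdet : ∀ y ∈ s, IsUnit (A y).det) (i j : ι) :
    ContDiffOn ℝ m (fun y => (A y)⁻¹ i j) s := by
  simp only [Matrix.inv_def, Ring.inverse_eq_inv', Matrix.smul_apply, smul_eq_mul,
    Matrix.adjugate_apply]
  refine ((contDiffOn_det hA).inv fun y hy => (hdet y hy).ne_zero).mul
    (contDiffOn_det fun a b => ?_)
  obtain rfl | hne := eq_or_ne a j
  · simpa using contDiffOn_const
  · simpa [Matrix.updateRow_ne hne] using hA a b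

end MatrixCalculus

section ProductRule

open Matrix

variable {ι : Type*} [Fintype ι]

lemma hasDerivAt_dotProduct_mulVec {G : ℝ → Matrix ι ι ℝ} {G' : Matrix ι ι ℝ} {u v : ℝ → ι → ℝ}
    {u' v' : ι → ℝ} {t : ℝ} (hG : ∀ i j, HasDerivAt (fun s => G s i j) (G' i j) t)
    (hu : ∀ i, HasDerivAt (fun s => u s i) (u' i) t)
    (hv : ∀ i, HasDerivAt (fun s => v s i) (v' i) t) :
    HasDerivAt (fun s => u s ⬝ᵥ G s *ᵥ v s)
      (u' ⬝ᵥ G t *ᵥ v t + u t ⬝ᵥ G' *ᵥ v t + u t ⬝ᵥ G t *ᵥ v') t := by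
  have hGv : ∀ i, HasDerivAt (fun s => (G s *ᵥ v s) i) ((G' *ᵥ v t) i + (G t *ᵥ v') i) t :=
    fun i => (HasDerivAt.fun_sum fun j _ => (hG i j).mul (hv j)).congr_deriv
      Finset.sum_add_distrib
  refine (HasDerivAt.fun_sum fun i (_ : i ∈ Finset.univ) => (hu i).mul (hGv i)).congr_deriv ?_
  simp only [mul_add, Finset.sum_add_distrib, dotProduct]
  ring

lemma hasDerivAt_dotProduct_mulVec_of_compatible {G : ℝ → Matrix ι ι ℝ} {Γ : Matrix ι ι ℝ}
    {u v : ℝ → ι → ℝ} {a b : ι → ℝ} {t : ℝ}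
    (hG : ∀ i j, HasDerivAt (fun s => G s i j) ((Γᵀ * G t + G t * Γ) i j) t)
    (hu : ∀ i, HasDerivAt (fun s => u s i) ((a - Γ *ᵥ u t) i) t)
    (hv : ∀ i, HasDerivAt (fun s => v s i) ((b - Γ *ᵥ v t) i) t) :
    HasDerivAt (fun s => u s ⬝ᵥ G s *ᵥ v s) (a ⬝ᵥ G t *ᵥ v t + u t ⬝ᵥ G t *ᵥ b) t := by
  refine (hasDerivAt_dotProduct_mulVec hG hu hv).congr_deriv ?_
  have htranspose : u t ⬝ᵥ Γᵀ *ᵥ G t *ᵥ v t = (Γ *ᵥ u t) ⬝ᵥ G t *ᵥ v t := by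
    rw [dotProduct_mulVec, vecMul_transpose]
  simp only [sub_dotProduct, mulVec_sub, dotProduct_sub, add_mulVec, dotProduct_add,
    ← mulVec_mulVec, htranspose]
  ring

end ProductRule

section PartialDeriv

variable {n : ℕ}

lemma contDiffOn_partialDeriv {f : EuclideanSpace ℝ (Fin n) → ℝ}
    {s : Set (EuclideanSpace ℝ (Fin n))} (hs : IsOpen s) (hf : ContDiffOn ℝ ∞ f s) (i : Fin n) :
    ContDiffOn ℝ ∞ (partialDeriv i f) s :=
  (hf.fderiv_of_isOpen hs (m := ∞) (by simp)).clm_apply contDiffOn_const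

lemma fderiv_eq_sum_partialDeriv (f : EuclideanSpace ℝ (Fin n) → ℝ)
    (y v : EuclideanSpace ℝ (Fin n)) : fderiv ℝ f y v = ∑ i, v i * partialDeriv i f y := by
  conv_lhs => rw [← (EuclideanSpace.basisFun (Fin n) ℝ).sum_repr v]
  simp [partialDeriv]

end PartialDeriv

section Charts

variable {n : ℕ} {M : Type*} [TopologicalSpace M] [ChartedSpace (EuclideanSpace ℝ (Fin n)) M]
  {x₀ x : M}

lemma extChartAt_symm_mem_chart_source {y : EuclideanSpace ℝ (Fin n)}
    (hy : y ∈ (extChartAt (𝓡 n) x₀).target) :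
    (extChartAt (𝓡 n) x₀).symm y ∈ (chartAt (EuclideanSpace ℝ (Fin n)) x₀).source := by
  simpa only [extChartAt_source] using (extChartAt (𝓡 n) x₀).map_target hy

lemma extChartAt_mem_target (hx : x ∈ (chartAt (EuclideanSpace ℝ (Fin n)) x₀).source) :
    extChartAt (𝓡 n) x₀ x ∈ (extChartAt (𝓡 n) x₀).target :=
  (extChartAt (𝓡 n) x₀).map_source (by rwa [extChartAt_source])

variable {γ : ℝ → M} {t : ℝ}

lemma eventually_mem_chart_source (hγ : ContinuousAt γ t)
    (ht : γ t ∈ (chartAt (EuclideanSpace ℝ (Fin n)) x₀).source) :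
    ∀ᶠ s in 𝓝 t, γ s ∈ (chartAt (EuclideanSpace ℝ (Fin n)) x₀).source :=
  hγ.eventually_mem ((chartAt (EuclideanSpace ℝ (Fin n)) x₀).open_source.mem_nhds ht)

lemma continuousAt_comp_extChartAt {f : EuclideanSpace ℝ (Fin n) → ℝ}
    (hf : ContDiffOn ℝ ∞ f (extChartAt (𝓡 n) x₀).target) (hγ : ContinuousAt γ t)
    (ht : γ t ∈ (chartAt (EuclideanSpace ℝ (Fin n)) x₀).source) :
    ContinuousAt (fun s => f (extChartAt (𝓡 n) x₀ (γ s))) t := by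
  have hf' : ContinuousAt f (extChartAt (𝓡 n) x₀ (γ t)) :=
    hf.continuousOn.continuousAt
      ((isOpen_extChartAt_target x₀).mem_nhds (extChartAt_mem_target ht))
  have hchart : ContinuousAt (extChartAt (𝓡 n) x₀) (γ t) :=
    continuousAt_extChartAt' (by rwa [extChartAt_source])
  exact hf'.comp (f := fun s => extChartAt (𝓡 n) x₀ (γ s)) (hchart.comp (x := t) hγ)

variable [IsManifold (𝓡 n) ∞ M]

lemma mem_baseSet_trivializationAt
    (hx : x ∈ (chartAt (EuclideanSpace ℝ (Fin n)) x₀).source) :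
    x ∈ (trivializationAt (EuclideanSpace ℝ (Fin n))
      (TangentSpace (𝓡 n) : M → Type _) x₀).baseSet := by
  rwa [TangentBundle.trivializationAt_baseSet]

lemma ofCoord_coord (hx : x ∈ (chartAt (EuclideanSpace ℝ (Fin n)) x₀).source)
    (u : TangentSpace (𝓡 n) x) : ofCoord x₀ x (coord x₀ x u) = u :=
  Bundle.Trivialization.symmL_continuousLinearMapAt _ (mem_baseSet_trivializationAt hx) u

lemma coord_ofCoord (hx : x ∈ (chartAt (EuclideanSpace ℝ (Fin n)) x₀).source)
    (a : EuclideanSpace ℝ (Fin n)) : coord x₀ x (ofCoord x₀ x a) = a :=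
  Bundle.Trivialization.continuousLinearMapAt_symmL _ (mem_baseSet_trivializationAt hx) a

lemma coord_injective (hx : x ∈ (chartAt (EuclideanSpace ℝ (Fin n)) x₀).source) :
    Function.Injective (coord (n := n) x₀ x) :=
  Function.LeftInverse.injective (ofCoord_coord hx)

lemma ofCoord_injective (hx : x ∈ (chartAt (EuclideanSpace ℝ (Fin n)) x₀).source) :
    Function.Injective (ofCoord (n := n) x₀ x) :=
  Function.LeftInverse.injective (coord_ofCoord hx)

/-- The coordinate vector field `∂ᵢ` of the chart around `x₀`. -/
noncomputable def coordField (x₀ : M) (i : Fin n) (x : M) : TangentSpace (𝓡 n) x :=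
  ofCoord x₀ x (EuclideanSpace.single i 1)

lemma ofCoord_eq_sum (x₀ x : M) (a : EuclideanSpace ℝ (Fin n)) :
    ofCoord x₀ x a = ∑ i, a i • coordField x₀ i x := by
  conv_lhs => rw [← (EuclideanSpace.basisFun (Fin n) ℝ).sum_repr a]
  simp [coordField]

lemma eq_sum_coord_smul (hx : x ∈ (chartAt (EuclideanSpace ℝ (Fin n)) x₀).source)
    (u : TangentSpace (𝓡 n) x) : u = ∑ i, coord x₀ x u i • coordField x₀ i x := by
  rw [← ofCoord_eq_sum, ofCoord_coord hx]

lemma linearIndependent_coordField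
    (hx : x ∈ (chartAt (EuclideanSpace ℝ (Fin n)) x₀).source) :
    LinearIndependent ℝ fun i : Fin n => coordField x₀ i x := by
  refine Fintype.linearIndependent_iff.2 fun g hg i => ?_
  have hzero : ofCoord x₀ x (WithLp.toLp 2 g) = 0 := (ofCoord_eq_sum x₀ x _).trans hg
  exact congrArg (· i) (ofCoord_injective hx (hzero.trans (map_zero _).symm))

lemma contMDiffOn_coordField (x₀ : M) (i : Fin n) :
    ContMDiffOn (𝓡 n) ((𝓡 n).prod 𝓘(ℝ, EuclideanSpace ℝ (Fin n))) ∞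
      (fun x => (⟨x, coordField x₀ i x⟩ : TangentBundle (𝓡 n) M))
      (chartAt (EuclideanSpace ℝ (Fin n)) x₀).source := by
  have hframe := (trivializationAt (EuclideanSpace ℝ (Fin n))
    (TangentSpace (𝓡 n) : M → Type _) x₀).contMDiffOn_localFrame_baseSet (I := 𝓡 n) ∞
    (EuclideanSpace.basisFun (Fin n) ℝ).toBasis i
  rw [TangentBundle.trivializationAt_baseSet] at hframe
  refine hframe.congr fun x hx => ?_
  have hbase := mem_baseSet_trivializationAt hx
  simp only [Bundle.Trivialization.localFrame_apply_of_mem_baseSet _ _ hbase,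
    Bundle.Trivialization.basisAt, Module.Basis.map_apply, coordField, ofCoord,
    OrthonormalBasis.coe_toBasis, EuclideanSpace.basisFun_apply,
    Bundle.Trivialization.linearEquivAt_symm_apply, Bundle.Trivialization.symmL_apply _ hbase]

lemma hasDerivAt_extChartAt_comp (hγ : MDifferentiableAt 𝓘(ℝ, ℝ) (𝓡 n) γ t)
    (ht : γ t ∈ (chartAt (EuclideanSpace ℝ (Fin n)) x₀).source) :
    HasDerivAt (fun s => extChartAt (𝓡 n) x₀ (γ s)) (coord x₀ (γ t) (velocity n γ t)) t := by
  have hchart := (mdifferentiableAt_extChartAt (I := 𝓡 n) ht).hasMFDerivAt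
  let F : ℝ →L[ℝ] EuclideanSpace ℝ (Fin n) :=
    (mfderiv (𝓡 n) 𝓘(ℝ, EuclideanSpace ℝ (Fin n)) (extChartAt (𝓡 n) x₀) (γ t)).comp
      (mfderiv 𝓘(ℝ, ℝ) (𝓡 n) γ t)
  have hcomp : HasFDerivAt (fun s => extChartAt (𝓡 n) x₀ (γ s)) F t :=
    (hchart.comp t hγ.hasMFDerivAt).hasFDerivAt
  unfold coord velocity
  rw [TangentBundle.continuousLinearMapAt_trivializationAt ht]
  exact hcomp.hasDerivAt

end Charts

section LeviCivita

open Matrix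

variable {n : ℕ} {M : Type*} [TopologicalSpace M] [ChartedSpace (EuclideanSpace ℝ (Fin n)) M]
  [IsManifold (𝓡 n) ∞ M] [Bundle.RiemannianBundle (fun x : M => TangentSpace (𝓡 n) x)]
  {x₀ : M} {y : EuclideanSpace ℝ (Fin n)}

lemma metricMatrix_extChartAt {x : M} (hx : x ∈ (chartAt (EuclideanSpace ℝ (Fin n)) x₀).source)
    (i j : Fin n) : metricMatrix x₀ (extChartAt (𝓡 n) x₀ x) i j =
      inner ℝ (coordField x₀ i x) (coordField x₀ j x) := by
  have hleft : (extChartAt (𝓡 n) x₀).symm (extChartAt (𝓡 n) x₀ x) = x :=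
    (extChartAt (𝓡 n) x₀).left_inv (by rwa [extChartAt_source])
  rw [metricMatrix, hleft]
  rfl

lemma metricMatrix_symm (x₀ : M) (y : EuclideanSpace ℝ (Fin n)) (i j : Fin n) :
    metricMatrix x₀ y i j = metricMatrix x₀ y j i := by
  simp only [metricMatrix, of_apply, real_inner_comm]

lemma inner_eq_dotProduct_metricMatrix {x : M}
    (hx : x ∈ (chartAt (EuclideanSpace ℝ (Fin n)) x₀).source) (u v : TangentSpace (𝓡 n) x) :
    inner ℝ u v = (coord x₀ x u).ofLp ⬝ᵥ
      metricMatrix x₀ (extChartAt (𝓡 n) x₀ x) *ᵥ (coord x₀ x v).ofLp := by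
  conv_lhs => rw [eq_sum_coord_smul hx u, eq_sum_coord_smul hx v]
  simp only [sum_inner, inner_sum, real_inner_smul_left, real_inner_smul_right, dotProduct,
    mulVec, metricMatrix_extChartAt hx, Finset.mul_sum]
  rw [Finset.sum_comm]
  exact Finset.sum_congr rfl fun i _ => Finset.sum_congr rfl fun j _ => by ring

lemma isUnit_det_metricMatrix (hy : y ∈ (extChartAt (𝓡 n) x₀).target) :
    IsUnit (metricMatrix x₀ y).det := by
  have hindep : LinearIndependent ℝ
      fun i : Fin n => coordField x₀ i ((extChartAt (𝓡 n) x₀).symm y) :=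
    linearIndependent_coordField (extChartAt_symm_mem_chart_source hy)
  have hgram := (det_gram_ne_zero_iff_linearIndependent (𝕜 := ℝ)).2 hindep
  exact hgram.isUnit

/-- The matrix `(Γ^k_ij)_kj` of `∇_{∂ᵢ}` in the coordinate frame. -/
noncomputable def christoffelMatrix (x₀ : M) (i : Fin n) (y : EuclideanSpace ℝ (Fin n)) :
    Matrix (Fin n) (Fin n) ℝ :=
  Matrix.of fun k j => christoffel x₀ k i j y

lemma metricMatrix_mul_christoffelMatrix_apply (hy : y ∈ (extChartAt (𝓡 n) x₀).target)
    (i l j : Fin n) :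
    (metricMatrix x₀ y * christoffelMatrix x₀ i y) l j =
      (1 / 2) * (partialDeriv i (fun z => metricMatrix x₀ z j l) y
        + partialDeriv j (fun z => metricMatrix x₀ z i l) y
        - partialDeriv l (fun z => metricMatrix x₀ z i j) y) := by
  let firstKind : Matrix (Fin n) (Fin n) ℝ := Matrix.of fun l j =>
    (1 / 2) * (partialDeriv i (fun z => metricMatrix x₀ z j l) y
      + partialDeriv j (fun z => metricMatrix x₀ z i l) y
      - partialDeriv l (fun z => metricMatrix x₀ z i j) y)
  have hraise : christoffelMatrix x₀ i y = (metricMatrix x₀ y)⁻¹ * firstKind := by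
    ext k j
    simp only [christoffelMatrix, christoffel, firstKind, of_apply, mul_apply, Finset.mul_sum]
    exact Finset.sum_congr rfl fun l _ => mul_left_comm _ _ _
  rw [hraise, mul_nonsing_inv_cancel_left _ _ (isUnit_det_metricMatrix hy)]
  rfl

lemma partialDeriv_metricMatrix (hy : y ∈ (extChartAt (𝓡 n) x₀).target) (l i j : Fin n) :
    partialDeriv l (fun z => metricMatrix x₀ z i j) y =
      ((christoffelMatrix x₀ l y)ᵀ * metricMatrix x₀ y
        + metricMatrix x₀ y * christoffelMatrix x₀ l y) i j := by
  have hsymm : (metricMatrix x₀ y)ᵀ = metricMatrix x₀ y := by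
    ext a b
    exact metricMatrix_symm x₀ y b a
  have htranspose : (christoffelMatrix x₀ l y)ᵀ * metricMatrix x₀ y =
      (metricMatrix x₀ y * christoffelMatrix x₀ l y)ᵀ := by
    rw [transpose_mul, hsymm]
  simp only [htranspose, Matrix.add_apply, transpose_apply,
    metricMatrix_mul_christoffelMatrix_apply hy, metricMatrix_symm x₀ _ j i]
  ring

/-- The matrix `Γ(v)` of the Levi-Civita connection form in the coordinate frame, so that
`∇_v V = ∂_v V + Γ(v)V`. -/
noncomputable def connectionMatrix (x₀ : M) (y v : EuclideanSpace ℝ (Fin n)) :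
    Matrix (Fin n) (Fin n) ℝ :=
  ∑ i, v i • christoffelMatrix x₀ i y

lemma fderiv_metricMatrix (hy : y ∈ (extChartAt (𝓡 n) x₀).target)
    (v : EuclideanSpace ℝ (Fin n)) (i j : Fin n) :
    fderiv ℝ (fun z => metricMatrix x₀ z i j) y v =
      ((connectionMatrix x₀ y v)ᵀ * metricMatrix x₀ y
        + metricMatrix x₀ y * connectionMatrix x₀ y v) i j := by
  simp only [fderiv_eq_sum_partialDeriv, partialDeriv_metricMatrix hy, connectionMatrix,
    transpose_sum, transpose_smul, Finset.sum_mul, Finset.mul_sum, ← Finset.sum_add_distrib,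
    smul_mul, Matrix.mul_smul, ← smul_add, Matrix.sum_apply, Matrix.smul_apply, smul_eq_mul]

variable [IsContMDiffRiemannianBundle (𝓡 n) ∞ (EuclideanSpace ℝ (Fin n))
  (fun x : M => TangentSpace (𝓡 n) x)]

lemma contDiffOn_metricMatrix (x₀ : M) (i j : Fin n) :
    ContDiffOn ℝ ∞ (fun y => metricMatrix x₀ y i j) (extChartAt (𝓡 n) x₀).target := by
  have hinner : ContMDiffOn (𝓡 n) 𝓘(ℝ, ℝ) ∞
      (fun x : M => inner ℝ (coordField (n := n) x₀ i x) (coordField x₀ j x))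
      (chartAt (EuclideanSpace ℝ (Fin n)) x₀).source :=
    (contMDiffOn_coordField x₀ i).inner_bundle (contMDiffOn_coordField x₀ j)
  exact (hinner.comp (contMDiffOn_extChartAt_symm (n := ∞) (I := 𝓡 n) x₀)
    fun y hy => extChartAt_symm_mem_chart_source hy).contDiffOn

lemma contDiffOn_christoffel (x₀ : M) (k i j : Fin n) :
    ContDiffOn ℝ ∞ (christoffel x₀ k i j) (extChartAt (𝓡 n) x₀).target := by
  have hopen : IsOpen (extChartAt (𝓡 n) x₀).target := isOpen_extChartAt_target x₀
  have hG := fun a b => contDiffOn_metricMatrix (n := n) x₀ a b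
  have hdG := fun l a b => contDiffOn_partialDeriv hopen (hG a b) l
  unfold christoffel
  exact contDiffOn_const.mul (ContDiffOn.sum fun l _ =>
    (contDiffOn_inv_apply hG (fun y hy => isUnit_det_metricMatrix hy) k l).mul
      (((hdG _ _ _).add (hdG _ _ _)).sub (hdG _ _ _)))

lemma contDiffOn_curvatureCoeff (x₀ : M) (l i j k : Fin n) :
    ContDiffOn ℝ ∞ (curvatureCoeff x₀ l i j k) (extChartAt (𝓡 n) x₀).target := by
  have hopen : IsOpen (extChartAt (𝓡 n) x₀).target := isOpen_extChartAt_target x₀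
  have hΓ := fun a b c => contDiffOn_christoffel (n := n) x₀ a b c
  unfold curvatureCoeff
  exact ((contDiffOn_partialDeriv hopen (hΓ _ _ _) _).sub
    (contDiffOn_partialDeriv hopen (hΓ _ _ _) _)).add
    (ContDiffOn.sum fun m _ => ((hΓ _ _ _).mul (hΓ _ _ _)).sub ((hΓ _ _ _).mul (hΓ _ _ _)))

end LeviCivita

section CovariantDerivative

open Matrix

variable {n : ℕ} {M : Type*} [TopologicalSpace M] [ChartedSpace (EuclideanSpace ℝ (Fin n)) M]
  [IsManifold (𝓡 n) ∞ M] [Bundle.RiemannianBundle (fun x : M => TangentSpace (𝓡 n) x)]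
  {γ : ℝ → M} {V W A B : ∀ t, TangentSpace (𝓡 n) (γ t)}

namespace IsCovDerivAlong

lemma add (hV : IsCovDerivAlong γ V A) (hW : IsCovDerivAlong γ W B) :
    IsCovDerivAlong γ (V + W) (A + B) := by
  intro x₀ t ht k
  refine (((hV x₀ t ht k).add (hW x₀ t ht k)).congr_deriv ?_).congr_of_eventuallyEq
    (.of_forall fun s => by simp)
  simp only [Pi.add_apply, map_add, PiLp.add_apply, mul_add, Finset.sum_add_distrib]
  ring

lemma smul (c : ℝ) (hV : IsCovDerivAlong γ V A) : IsCovDerivAlong γ (c • V) (c • A) := by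
  intro x₀ t ht k
  refine (((hV x₀ t ht k).const_mul c).congr_deriv ?_).congr_of_eventuallyEq
    (.of_forall fun s => by simp)
  simp only [Pi.smul_apply, map_smul, PiLp.smul_apply, smul_eq_mul, mul_sub, Finset.mul_sum]
  congr 1
  exact Finset.sum_congr rfl fun i _ => Finset.sum_congr rfl fun j _ => by ring

lemma sub (hV : IsCovDerivAlong γ V A) (hW : IsCovDerivAlong γ W B) :
    IsCovDerivAlong γ (V - W) (A - B) := by
  simpa [sub_eq_add_neg] using hV.add (hW.smul (-1))

lemma unique (hA : IsCovDerivAlong γ V A) (hB : IsCovDerivAlong γ V B) : A = B := by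
  funext t
  have ht := mem_chart_source (EuclideanSpace ℝ (Fin n)) (γ t)
  refine coord_injective ht (PiLp.ext fun k => ?_)
  simpa using (hA (γ t) t ht k).unique (hB (γ t) t ht k)

lemma hasDerivAt_coord (hV : IsCovDerivAlong γ V A) {x₀ : M} {t : ℝ}
    (ht : γ t ∈ (chartAt (EuclideanSpace ℝ (Fin n)) x₀).source) (k : Fin n) :
    HasDerivAt (fun s => coord x₀ (γ s) (V s) k)
      (((coord x₀ (γ t) (A t)).ofLp -
        connectionMatrix x₀ (extChartAt (𝓡 n) x₀ (γ t)) (coord x₀ (γ t) (velocity n γ t)) *ᵥ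
          (coord x₀ (γ t) (V t)).ofLp) k) t := by
  refine (hV x₀ t ht k).congr_deriv ?_
  simp only [connectionMatrix, christoffelMatrix, Pi.sub_apply, mulVec, dotProduct,
    Matrix.sum_apply, Matrix.smul_apply, smul_eq_mul, of_apply, Finset.sum_mul]
  rw [Finset.sum_comm]
  congr 1
  exact Finset.sum_congr rfl fun j _ => Finset.sum_congr rfl fun i _ => by ring

lemma continuousAt_coord (hV : IsCovDerivAlong γ V A) {x₀ : M} {t : ℝ}
    (ht : γ t ∈ (chartAt (EuclideanSpace ℝ (Fin n)) x₀).source) :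
    ContinuousAt (fun s => coord x₀ (γ s) (V s)) t :=
  (PiLp.continuous_toLp 2 _).continuousAt.comp
    (continuousAt_pi.2 fun k => (hV x₀ t ht k).continuousAt)

variable [IsContMDiffRiemannianBundle (𝓡 n) ∞ (EuclideanSpace ℝ (Fin n))
  (fun x : M => TangentSpace (𝓡 n) x)]

theorem hasDerivAt_inner (hγ : ContMDiff 𝓘(ℝ, ℝ) (𝓡 n) ∞ γ) (hV : IsCovDerivAlong γ V A)
    (hW : IsCovDerivAlong γ W B) (t : ℝ) :
    HasDerivAt (fun s => inner ℝ (V s) (W s)) (inner ℝ (A t) (W t) + inner ℝ (V t) (B t)) t := by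
  have ht := mem_chart_source (EuclideanSpace ℝ (Fin n)) (γ t)
  have htarget := extChartAt_mem_target ht
  have hmetric : ∀ i j, HasDerivAt
      (fun s => metricMatrix (γ t) (extChartAt (𝓡 n) (γ t) (γ s)) i j)
      (((connectionMatrix (γ t) (extChartAt (𝓡 n) (γ t) (γ t))
            (coord (γ t) (γ t) (velocity n γ t)))ᵀ
          * metricMatrix (γ t) (extChartAt (𝓡 n) (γ t) (γ t))
        + metricMatrix (γ t) (extChartAt (𝓡 n) (γ t) (γ t))
          * connectionMatrix (γ t) (extChartAt (𝓡 n) (γ t) (γ t))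
            (coord (γ t) (γ t) (velocity n γ t))) i j) t := by
    intro i j
    have hdiff : DifferentiableAt ℝ (fun z => metricMatrix (γ t) z i j)
        (extChartAt (𝓡 n) (γ t) (γ t)) :=
      ((contDiffOn_metricMatrix (γ t) i j).contDiffAt
        ((isOpen_extChartAt_target (γ t)).mem_nhds htarget)).differentiableAt (by simp)
    rw [← fderiv_metricMatrix htarget]
    exact hdiff.hasFDerivAt.comp_hasDerivAt t
      (hasDerivAt_extChartAt_comp ((hγ t).mdifferentiableAt (by simp)) ht)
  rw [inner_eq_dotProduct_metricMatrix ht, inner_eq_dotProduct_metricMatrix ht]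
  refine (hasDerivAt_dotProduct_mulVec_of_compatible hmetric (hV.hasDerivAt_coord ht)
    (hW.hasDerivAt_coord ht)).congr_of_eventuallyEq ?_
  filter_upwards [eventually_mem_chart_source hγ.continuous.continuousAt ht] with s hs
  exact inner_eq_dotProduct_metricMatrix hs _ _

end IsCovDerivAlong

end CovariantDerivative

section LocalBounds

variable {n : ℕ} {M : Type*} [TopologicalSpace M] [ChartedSpace (EuclideanSpace ℝ (Fin n)) M]
  [IsManifold (𝓡 n) ∞ M] [Bundle.RiemannianBundle (fun x : M => TangentSpace (𝓡 n) x)]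

instance isContinuousRiemannianBundle_tangentSpace
    [h : IsContMDiffRiemannianBundle (𝓡 n) ∞ (EuclideanSpace ℝ (Fin n))
      (fun x : M => TangentSpace (𝓡 n) x)] :
    IsContinuousRiemannianBundle (EuclideanSpace ℝ (Fin n))
      (fun x : M => TangentSpace (𝓡 n) x) where
  exists_continuous :=
    let ⟨g, hsmooth, hg⟩ := h.exists_contMDiff
    ⟨g, hsmooth.continuous, hg⟩

variable [IsContinuousRiemannianBundle (EuclideanSpace ℝ (Fin n))
  (fun x : M => TangentSpace (𝓡 n) x)] {x₀ x : M}

lemma exists_norm_coord_le (hx : x ∈ (chartAt (EuclideanSpace ℝ (Fin n)) x₀).source) :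
    ∃ C, ∀ᶠ y in 𝓝 x, ∀ u : TangentSpace (𝓡 n) y, ‖coord x₀ y u‖ ≤ C * ‖u‖ := by
  let e := trivializationAt (EuclideanSpace ℝ (Fin n)) (TangentSpace (𝓡 n) : M → Type _) x
  let e₀ := trivializationAt (EuclideanSpace ℝ (Fin n)) (TangentSpace (𝓡 n) : M → Type _) x₀
  let change (y : M) : EuclideanSpace ℝ (Fin n) →L[ℝ] EuclideanSpace ℝ (Fin n) :=
    (e.coordChangeL ℝ e₀ y).toContinuousLinearMap
  have hbase : e.baseSet ∩ e₀.baseSet ∈ 𝓝 x :=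
    (e.open_baseSet.inter e₀.open_baseSet).mem_nhds
      ⟨FiberBundle.mem_baseSet_trivializationAt' x, mem_baseSet_trivializationAt hx⟩
  have hchange : ContinuousAt (fun y => ‖change y‖) x :=
    ((continuousOn_coordChange ℝ e e₀).continuousAt hbase).norm
  obtain ⟨C, -, hcoord⟩ := eventually_norm_trivializationAt_lt (EuclideanSpace ℝ (Fin n))
    (fun x : M => TangentSpace (𝓡 n) x) x
  refine ⟨(‖change x‖ + 1) * C, ?_⟩
  filter_upwards [hcoord, hbase, hchange.eventually_lt continuousAt_const (lt_add_one _)]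
    with y hy hmem hlt u
  have hcomp : coord x₀ y u = change y (e.continuousLinearMapAt ℝ y u) := by
    have hsymm : e.symm y (e.continuousLinearMapAt ℝ y u) = u :=
      (e.symmL_apply (R := ℝ) hmem.1 _).symm.trans (e.symmL_continuousLinearMapAt hmem.1 u)
    refine (e₀.continuousLinearMapAt_apply_of_mem (R := ℝ) hmem.2 u).trans ?_
    refine Eq.trans ?_ (e.coordChangeL_apply e₀ hmem _).symm
    rw [hsymm]
  rw [hcomp, mul_assoc]
  exact (change y).le_of_opNorm_le_of_le hlt.le (ContinuousLinearMap.le_of_opNorm_le _ hy.le u)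

lemma exists_norm_ofCoord_le (x : M) :
    ∃ C, ∀ᶠ y in 𝓝 x, ∀ a : EuclideanSpace ℝ (Fin n), ‖ofCoord x y a‖ ≤ C * ‖a‖ := by
  obtain ⟨C, -, hC⟩ := eventually_norm_symmL_trivializationAt_lt (EuclideanSpace ℝ (Fin n))
    (fun x : M => TangentSpace (𝓡 n) x) x
  refine ⟨C, ?_⟩
  filter_upwards [hC] with y hy
  exact ContinuousLinearMap.le_of_opNorm_le _ hy.le

lemma isCovDerivAlong_zero_of_isLittleO {γ : ℝ → M} (hγ : Continuous γ)
    {W : ∀ t, TangentSpace (𝓡 n) (γ t)}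
    (h : ∀ t₀, ∃ V V' : ∀ t, TangentSpace (𝓡 n) (γ t), IsCovDerivAlong γ V V' ∧ V' t₀ = 0 ∧
      W t₀ = V t₀ ∧ (fun t => ‖W t - V t‖) =o[𝓝 t₀] fun t => t - t₀) :
    IsCovDerivAlong γ W 0 := by
  intro x₀ t ht k
  obtain ⟨V, V', hV, hV', hWV, hlittle⟩ := h t
  obtain ⟨C, hC⟩ := exists_norm_coord_le ht
  have hdiff : HasDerivAt (fun s => coord x₀ (γ s) (W s - V s) k) 0 t := by
    have hbig : (fun s => coord x₀ (γ s) (W s - V s) k) =O[𝓝 t] fun s => ‖W s - V s‖ := by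
      refine .of_bound C ?_
      filter_upwards [hγ.continuousAt.eventually hC] with s hs
      rw [norm_norm]
      exact (PiLp.norm_apply_le _ k).trans (hs _)
    rw [hasDerivAt_iff_isLittleO]
    simpa [hWV] using hbig.trans_isLittleO hlittle
  refine ((hdiff.add (hV x₀ t ht k)).congr_deriv ?_).congr_of_eventuallyEq
    (.of_forall fun s => by simp)
  rw [hV', hWV]
  simp

end LocalBounds

section Curvature

variable {n : ℕ} {M : Type*} [TopologicalSpace M] [ChartedSpace (EuclideanSpace ℝ (Fin n)) M]
  [IsManifold (𝓡 n) ∞ M] [Bundle.RiemannianBundle (fun x : M => TangentSpace (𝓡 n) x)]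

/-- The operator `R(·, v)v` at `x`, acting on components in the chart around `x₀`. -/
noncomputable def curvatureCLM (x₀ x : M) (v : TangentSpace (𝓡 n) x) :
    EuclideanSpace ℝ (Fin n) →L[ℝ] EuclideanSpace ℝ (Fin n) :=
  Matrix.toEuclideanCLM (𝕜 := ℝ) (Matrix.of fun l i => ∑ j, ∑ k,
    curvatureCoeff x₀ l i j k (extChartAt (𝓡 n) x₀ x) * coord x₀ x v j * coord x₀ x v k)

lemma curvature_eq_ofCoord (x₀ x : M) (u v : TangentSpace (𝓡 n) x) :
    curvature x₀ x u v v = ofCoord x₀ x (curvatureCLM x₀ x v (coord x₀ x u)) := by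
  unfold curvature curvatureCLM
  congr 1
  refine PiLp.ext fun l => ?_
  simp only [Matrix.ofLp_toEuclideanCLM, Matrix.mulVec, dotProduct, Matrix.of_apply,
    Finset.sum_mul]
  exact Finset.sum_congr rfl fun i _ => Finset.sum_congr rfl fun j _ =>
    Finset.sum_congr rfl fun k _ => by ring

variable [IsContMDiffRiemannianBundle (𝓡 n) ∞ (EuclideanSpace ℝ (Fin n))
  (fun x : M => TangentSpace (𝓡 n) x)] {γ : ℝ → M} {x₀ : M} {t₀ : ℝ}

lemma continuousAt_curvatureCLM (hγ : IsUnitSpeedGeodesic n γ)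
    (ht : γ t₀ ∈ (chartAt (EuclideanSpace ℝ (Fin n)) x₀).source) :
    ContinuousAt (fun t => curvatureCLM x₀ (γ t) (velocity n γ t)) t₀ := by
  have hvel := fun j => (hγ.2.1 x₀ t₀ ht j).continuousAt
  have hmatrix : ContinuousAt (fun t => Matrix.of fun l i => ∑ j, ∑ k,
      curvatureCoeff x₀ l i j k (extChartAt (𝓡 n) x₀ (γ t)) *
        coord x₀ (γ t) (velocity n γ t) j * coord x₀ (γ t) (velocity n γ t) k) t₀ := by
    refine continuousAt_pi.2 fun l => continuousAt_pi.2 fun i => ?_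
    simp only [Matrix.of_apply]
    exact tendsto_finsetSum _ fun j _ => tendsto_finsetSum _ fun k _ =>
      ((continuousAt_comp_extChartAt (contDiffOn_curvatureCoeff x₀ l i j k)
        hγ.1.continuous.continuousAt ht).mul (hvel j)).mul (hvel k)
  have hlin : Continuous (Matrix.toEuclideanCLM (n := Fin n) (𝕜 := ℝ)) :=
    LinearMap.continuous_of_finiteDimensional
      (Matrix.toEuclideanCLM (n := Fin n) (𝕜 := ℝ)).toAlgEquiv.toLinearMap
  exact hlin.continuousAt.comp hmatrix

lemma exists_norm_curvature_le (hγ : IsUnitSpeedGeodesic n γ) (t₀ : ℝ) :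
    ∃ C, ∀ᶠ t in 𝓝 t₀, ∀ u : TangentSpace (𝓡 n) (γ t),
      ‖curvature (γ t₀) (γ t) u (velocity n γ t) (velocity n γ t)‖ ≤ C * ‖u‖ := by
  have ht := mem_chart_source (EuclideanSpace ℝ (Fin n)) (γ t₀)
  have hcont : ContinuousAt γ t₀ := hγ.1.continuous.continuousAt
  obtain ⟨C₁, hC₁⟩ := exists_norm_coord_le ht
  obtain ⟨C₂, hC₂⟩ := exists_norm_ofCoord_le (n := n) (γ t₀)
  have hCLM := (continuousAt_curvatureCLM hγ ht).norm
  refine ⟨|C₂| * ((‖curvatureCLM (γ t₀) (γ t₀) (velocity n γ t₀)‖ + 1) * C₁), ?_⟩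
  filter_upwards [hcont.eventually hC₁, hcont.eventually hC₂,
    hCLM.eventually_lt continuousAt_const (lt_add_one _)] with t hcoord hofCoord hlt u
  rw [curvature_eq_ofCoord, mul_assoc, mul_assoc]
  refine (hofCoord _).trans (mul_le_mul (le_abs_self _) ?_ (norm_nonneg _) (abs_nonneg _))
  exact ContinuousLinearMap.le_of_opNorm_le_of_le _ hlt.le (hcoord u)

lemma curvature_eq_zero_of_eventually (hγ : IsUnitSpeedGeodesic n γ)
    (ht : γ t₀ ∈ (chartAt (EuclideanSpace ℝ (Fin n)) x₀).source)
    {V V' : ∀ t, TangentSpace (𝓡 n) (γ t)} (hV : IsCovDerivAlong γ V V')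
    (h : ∀ᶠ t in 𝓝[≠] t₀, curvature x₀ (γ t) (V t) (velocity n γ t) (velocity n γ t) = 0) :
    curvature x₀ (γ t₀) (V t₀) (velocity n γ t₀) (velocity n γ t₀) = 0 := by
  have hcont := (continuousAt_curvatureCLM hγ ht).clm_apply (hV.continuousAt_coord ht)
  have hzero : curvatureCLM x₀ (γ t₀) (velocity n γ t₀) (coord x₀ (γ t₀) (V t₀)) = 0 := by
    refine tendsto_nhds_unique (l := 𝓝[≠] t₀) (hcont.tendsto.mono_left nhdsWithin_le_nhds)
      (tendsto_const_nhds.congr' ?_)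
    filter_upwards [h, nhdsWithin_le_nhds
      (eventually_mem_chart_source hγ.1.continuous.continuousAt ht)] with t hcurv hs
    rw [curvature_eq_ofCoord] at hcurv
    exact (ofCoord_injective hs (hcurv.trans (map_zero _).symm)).symm
  rw [curvature_eq_ofCoord, hzero, map_zero]

end Curvature

section Uniqueness

variable {n : ℕ} {M : Type*} [TopologicalSpace M] [ChartedSpace (EuclideanSpace ℝ (Fin n)) M]
  [IsManifold (𝓡 n) ∞ M] [Bundle.RiemannianBundle (fun x : M => TangentSpace (𝓡 n) x)]
  [IsContMDiffRiemannianBundle (𝓡 n) ∞ (EuclideanSpace ℝ (Fin n))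
    (fun x : M => TangentSpace (𝓡 n) x)]

lemma IsCovDerivAlong.eq_zero_of_norm_le {γ : ℝ → M} (hγ : ContMDiff 𝓘(ℝ, ℝ) (𝓡 n) ∞ γ)
    {V W A : ∀ t, TangentSpace (𝓡 n) (γ t)} (hV : IsCovDerivAlong γ V W)
    (hW : IsCovDerivAlong γ W A) (hbound : ∀ t₀, ∃ C, ∀ᶠ t in 𝓝 t₀, ‖A t‖ ≤ C * ‖V t‖)
    {t₀ : ℝ} (hV₀ : V t₀ = 0) (hW₀ : W t₀ = 0) : V = 0 := by
  have hderiv : ∀ t, HasDerivAt (fun s => inner ℝ (V s) (V s) + inner ℝ (W s) (W s))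
      (2 * (inner ℝ (V t) (W t) + inner ℝ (A t) (W t))) t := fun t => by
    refine ((hV.hasDerivAt_inner hγ hV t).add (hW.hasDerivAt_inner hγ hW t)).congr_deriv ?_
    rw [real_inner_comm (V t) (W t), real_inner_comm (A t) (W t)]
    ring
  have henergy := eq_zero_of_eventually_norm_deriv_le hderiv (fun a => ?_) (t₀ := t₀)
    (by simp [hV₀, hW₀])
  · funext t
    have hsum := congrFun henergy t
    simp only [real_inner_self_eq_norm_sq, Pi.zero_apply] at hsum
    exact norm_eq_zero.1 (by nlinarith [sq_nonneg ‖W t‖, norm_nonneg (V t)])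
  · obtain ⟨C, hC⟩ := hbound a
    refine ⟨1 + |C|, ?_⟩
    filter_upwards [hC] with t ht
    rw [real_inner_self_eq_norm_sq, real_inner_self_eq_norm_sq,
      Real.norm_of_nonneg (by positivity : 0 ≤ ‖V t‖ ^ 2 + ‖W t‖ ^ 2)]
    have hA : ‖A t‖ * ‖W t‖ ≤ |C| * ‖V t‖ * ‖W t‖ := by
      gcongr
      exact ht.trans (by gcongr; exact le_abs_self C)
    calc ‖2 * (inner ℝ (V t) (W t) + inner ℝ (A t) (W t))‖
        = 2 * |inner ℝ (V t) (W t) + inner ℝ (A t) (W t)| := by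
          rw [norm_mul, Real.norm_two, Real.norm_eq_abs]
      _ ≤ 2 * (‖V t‖ * ‖W t‖ + ‖A t‖ * ‖W t‖) := by
          gcongr
          exact (abs_add_le _ _).trans
            (add_le_add (abs_real_inner_le_norm _ _) (abs_real_inner_le_norm _ _))
      _ ≤ (1 + |C|) * (2 * ‖V t‖ * ‖W t‖) := by linarith
      _ ≤ (1 + |C|) * (‖V t‖ ^ 2 + ‖W t‖ ^ 2) := by
          gcongr
          exact two_mul_le_add_sq _ _

end Uniqueness

section JacobiField

variable {n : ℕ} {M : Type*} [TopologicalSpace M] [ChartedSpace (EuclideanSpace ℝ (Fin n)) M]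
  [IsManifold (𝓡 n) ∞ M] [Bundle.RiemannianBundle (fun x : M => TangentSpace (𝓡 n) x)]
  {γ : ℝ → M} {V W J K : ∀ t, TangentSpace (𝓡 n) (γ t)}

open Classical in
/-- The covariant derivative of a field `V` along `γ`, and `0` if `V` is not differentiable. -/
noncomputable def covDeriv (γ : ℝ → M) (V : ∀ t, TangentSpace (𝓡 n) (γ t)) :
    ∀ t, TangentSpace (𝓡 n) (γ t) :=
  if h : ∃ W, IsCovDerivAlong γ V W then h.choose else 0

lemma IsCovDerivAlong.covDeriv_eq (h : IsCovDerivAlong γ V W) : covDeriv γ V = W := by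
  have hex : ∃ W, IsCovDerivAlong γ V W := ⟨W, h⟩
  rw [covDeriv, dif_pos hex]
  exact hex.choose_spec.unique h

lemma isCovDerivAlong_zero_zero (γ : ℝ → M) : IsCovDerivAlong (n := n) γ 0 0 :=
  (parallelFields γ).zero_mem

namespace IsJacobiField

lemma isCovDerivAlong_covDeriv (hJ : IsJacobiField γ J) : IsCovDerivAlong γ J (covDeriv γ J) := by
  obtain ⟨W, A, hW, -⟩ := hJ
  rwa [hW.covDeriv_eq]

lemma isCovDerivAlong_covDeriv_covDeriv (hJ : IsJacobiField γ J) :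
    IsCovDerivAlong γ (covDeriv γ J) (covDeriv γ (covDeriv γ J)) := by
  obtain ⟨W, A, hW, hA, -⟩ := hJ
  rwa [hW.covDeriv_eq, hA.covDeriv_eq]

lemma covDeriv_covDeriv (hJ : IsJacobiField γ J) {x₀ : M} {t : ℝ}
    (ht : γ t ∈ (chartAt (EuclideanSpace ℝ (Fin n)) x₀).source) :
    covDeriv γ (covDeriv γ J) t =
      -curvature x₀ (γ t) (J t) (velocity n γ t) (velocity n γ t) := by
  obtain ⟨W, A, hW, hA, hR⟩ := hJ
  rw [hW.covDeriv_eq, hA.covDeriv_eq]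
  exact eq_neg_of_add_eq_zero_left (hR x₀ t ht)

lemma sub (hJ : IsJacobiField γ J) (hK : IsJacobiField γ K) : IsJacobiField γ (J - K) := by
  refine ⟨_, _, hJ.isCovDerivAlong_covDeriv.sub hK.isCovDerivAlong_covDeriv,
    hJ.isCovDerivAlong_covDeriv_covDeriv.sub hK.isCovDerivAlong_covDeriv_covDeriv,
    fun x₀ t ht => ?_⟩
  simp only [Pi.sub_apply, hJ.covDeriv_covDeriv ht, hK.covDeriv_covDeriv ht,
    curvature_eq_ofCoord, map_sub]
  abel

lemma eq_zero [IsContMDiffRiemannianBundle (𝓡 n) ∞ (EuclideanSpace ℝ (Fin n))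
    (fun x : M => TangentSpace (𝓡 n) x)] (hγ : IsUnitSpeedGeodesic n γ)
    (hJ : IsJacobiField γ J) {t : ℝ} (ht : J t = 0) (ht' : covDeriv γ J t = 0) : J = 0 := by
  refine hJ.isCovDerivAlong_covDeriv.eq_zero_of_norm_le hγ.1
    hJ.isCovDerivAlong_covDeriv_covDeriv (fun t₀ => ?_) ht ht'
  obtain ⟨C, hC⟩ := exists_norm_curvature_le hγ t₀
  refine ⟨C, ?_⟩
  filter_upwards [hC, eventually_mem_chart_source hγ.1.continuous.continuousAt
    (mem_chart_source (EuclideanSpace ℝ (Fin n)) (γ t₀))] with t hbound hs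
  rw [hJ.covDeriv_covDeriv hs, norm_neg]
  exact hbound _

end IsJacobiField

end JacobiField

section Normal

variable {n : ℕ} {M : Type*} [TopologicalSpace M] [ChartedSpace (EuclideanSpace ℝ (Fin n)) M]

instance finiteDimensional_tangentSpace (x : M) : FiniteDimensional ℝ (TangentSpace (𝓡 n) x) :=
  inferInstanceAs (FiniteDimensional ℝ (EuclideanSpace ℝ (Fin n)))

lemma finrank_tangentSpace (x : M) : Module.finrank ℝ (TangentSpace (𝓡 n) x) = n :=
  finrank_euclideanSpace_fin (𝕜 := ℝ)

variable [Bundle.RiemannianBundle (fun x : M => TangentSpace (𝓡 n) x)] {γ : ℝ → M} {t : ℝ}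

/-- The orthogonal complement of the velocity. -/
noncomputable def normalSpace (γ : ℝ → M) (t : ℝ) : Submodule ℝ (TangentSpace (𝓡 n) (γ t)) :=
  (ℝ ∙ velocity n γ t)ᗮ

lemma mem_normalSpace {u : TangentSpace (𝓡 n) (γ t)} :
    u ∈ normalSpace γ t ↔ inner ℝ u (velocity n γ t) = 0 :=
  Submodule.mem_orthogonal_singleton_iff_inner_left

variable [IsManifold (𝓡 n) ∞ M]

lemma finrank_normalSpace (hγ : IsUnitSpeedGeodesic n γ) (t : ℝ) :
    Module.finrank ℝ (normalSpace (n := n) γ t) + 1 = n := by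
  have hv : velocity n γ t ≠ 0 := fun h => by simpa [h] using hγ.2.2 t
  have hsum := Submodule.finrank_add_finrank_orthogonal (ℝ ∙ velocity n γ t)
  rwa [finrank_span_singleton hv, finrank_tangentSpace, add_comm] at hsum

lemma orthonormal_cons_velocity (hγ : IsUnitSpeedGeodesic n γ) {k : ℕ}
    {w : Fin k → TangentSpace (𝓡 n) (γ t)} (hw : Orthonormal ℝ w)
    (hnormal : ∀ i, w i ∈ normalSpace γ t) :
    Orthonormal ℝ (Fin.cons (velocity n γ t) w : Fin (k + 1) → TangentSpace (𝓡 n) (γ t)) := by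
  refine orthonormal_iff_ite.2
    (Fin.cases (Fin.cases ?_ fun j => ?_) fun i => Fin.cases ?_ fun j => ?_)
  · simp [hγ.2.2 t]
  · simpa [real_inner_comm, (Fin.succ_ne_zero j).symm] using mem_normalSpace.1 (hnormal j)
  · simpa using mem_normalSpace.1 (hnormal i)
  · simpa using orthonormal_iff_ite.1 hw i j

lemma sectionalCurvature_eq (hγ : IsUnitSpeedGeodesic n γ) {w : TangentSpace (𝓡 n) (γ t)}
    (hw : ‖w‖ = 1) (hnormal : w ∈ normalSpace γ t) (x₀ : M) :
    sectionalCurvature x₀ (γ t) (velocity n γ t) w =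
      inner ℝ (curvature x₀ (γ t) w (velocity n γ t) (velocity n γ t)) w := by
  rw [sectionalCurvature, real_inner_comm w (velocity n γ t), mem_normalSpace.1 hnormal,
    real_inner_self_eq_norm_sq, real_inner_self_eq_norm_sq, hw, hγ.2.2 t]
  norm_num

lemma IsCovDerivAlong.mem_normalSpace [IsContMDiffRiemannianBundle (𝓡 n) ∞
    (EuclideanSpace ℝ (Fin n)) (fun x : M => TangentSpace (𝓡 n) x)]
    (hγ : IsUnitSpeedGeodesic n γ) {V W : ∀ t, TangentSpace (𝓡 n) (γ t)}
    (hV : IsCovDerivAlong γ V W) (hnormal : ∀ t, inner ℝ (V t) (velocity n γ t) = 0) (t : ℝ) :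
    W t ∈ normalSpace γ t := by
  have hderiv := hV.hasDerivAt_inner hγ.1 hγ.2.1 t
  simp only [hnormal] at hderiv
  simpa [JacobiSplitting.mem_normalSpace] using hderiv.unique (hasDerivAt_const t (0 : ℝ))

end Normal

section JacobiFamily

variable {n : ℕ} {M : Type*} [TopologicalSpace M] [ChartedSpace (EuclideanSpace ℝ (Fin n)) M]
  [IsManifold (𝓡 n) ∞ M] [Bundle.RiemannianBundle (fun x : M => TangentSpace (𝓡 n) x)]
  {γ : ℝ → M} {Λ : Submodule ℝ (∀ t, TangentSpace (𝓡 n) (γ t))}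

/-- The linear map `J ↦ J'(t)` on a space of Jacobi fields. -/
noncomputable def covDerivAt (hΛ : ∀ J ∈ Λ, IsJacobiField γ J) (t : ℝ) :
    Λ →ₗ[ℝ] TangentSpace (𝓡 n) (γ t) where
  toFun J := covDeriv γ J t
  map_add' J K := congrFun ((hΛ J J.2).isCovDerivAlong_covDeriv.add
    (hΛ K K.2).isCovDerivAlong_covDeriv).covDeriv_eq t
  map_smul' c J := congrFun ((hΛ J J.2).isCovDerivAlong_covDeriv.smul c).covDeriv_eq t

variable [IsContMDiffRiemannianBundle (𝓡 n) ∞ (EuclideanSpace ℝ (Fin n))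
  (fun x : M => TangentSpace (𝓡 n) x)]

lemma finiteDimensional_of_isJacobiField (hγ : IsUnitSpeedGeodesic n γ)
    (hΛ : ∀ J ∈ Λ, IsJacobiField γ J) : FiniteDimensional ℝ Λ := by
  refine Module.Finite.of_injective ((LinearMap.proj 0 ∘ₗ Λ.subtype).prod (covDerivAt hΛ 0))
    (LinearMap.ker_eq_bot.1 (LinearMap.ker_eq_bot'.2 fun J hJ => ?_))
  obtain ⟨hvalue, hderiv⟩ := Prod.ext_iff.1 hJ
  exact Subtype.ext ((hΛ J J.2).eq_zero hγ hvalue hderiv)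

/-- The Lagrangian family given by a space of Jacobi fields with self-adjoint Riccati
operator. -/
noncomputable def jacobiFamily (hγ : IsUnitSpeedGeodesic n γ)
    (hΛ : ∀ J ∈ Λ, IsJacobiField γ J) (hS : RiccatiSelfAdjoint γ Λ) :
    LagrangianFamily Λ fun t => TangentSpace (𝓡 n) (γ t) where
  ev t := (LinearMap.proj t : (∀ t, TangentSpace (𝓡 n) (γ t)) →ₗ[ℝ] _) ∘ₗ Λ.subtype
  dv := covDerivAt hΛ
  R t u := curvature (γ t) (γ t) u (velocity n γ t) (velocity n γ t)
  hasDerivAt_ev J K t := (hΛ J J.2).isCovDerivAlong_covDeriv.hasDerivAt_inner hγ.1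
    (hΛ K K.2).isCovDerivAlong_covDeriv t
  hasDerivAt_dv J K t := by
    refine ((hΛ J J.2).isCovDerivAlong_covDeriv_covDeriv.hasDerivAt_inner hγ.1
      (hΛ K K.2).isCovDerivAlong_covDeriv t).congr_deriv ?_
    rw [(hΛ J J.2).covDeriv_covDeriv (mem_chart_source _ (γ t)), inner_neg_left]
    rfl
  symm J K t := hS J J.2 K K.2 _ _ (hΛ J J.2).isCovDerivAlong_covDeriv
    (hΛ K K.2).isCovDerivAlong_covDeriv t
  eq_zero J _ ht ht' := Subtype.ext ((hΛ J J.2).eq_zero hγ ht ht')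

variable {hγ : IsUnitSpeedGeodesic n γ} {hΛ : ∀ J ∈ Λ, IsJacobiField γ J}
  {hS : RiccatiSelfAdjoint γ Λ}

lemma sum_sectionalCurvature_eq_curvatureSum {k : ℕ} {t : ℝ} {J : Fin k → Λ}
    (hJ : Orthonormal ℝ fun i => (jacobiFamily hγ hΛ hS).ev t (J i))
    (hnormal : ∀ J ∈ Λ, ∀ t, inner ℝ (J t) (velocity n γ t) = 0) :
    ∑ i, sectionalCurvature (γ t) (γ t) (velocity n γ t) ((J i).1 t) =
      (jacobiFamily hγ hΛ hS).curvatureSum t J :=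
  Finset.sum_congr rfl fun i _ =>
    sectionalCurvature_eq hγ (hJ.1 i) (mem_normalSpace.2 (hnormal _ (J i).2 t)) _

lemma hasNonnegRicci_jacobiFamily {k : ℕ} (hRic : RicNonneg n k γ)
    (hnormal : ∀ J ∈ Λ, ∀ t, inner ℝ (J t) (velocity n γ t) = 0) :
    (jacobiFamily hγ hΛ hS).HasNonnegRicci k := fun t J hJ => by
  rw [← sum_sectionalCurvature_eq_curvatureSum hJ hnormal]
  exact hRic t _ (orthonormal_cons_velocity hγ hJ fun i =>
    mem_normalSpace.2 (hnormal _ (J i).2 t)) _ (mem_chart_source _ _)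

lemma hasPosRicci_jacobiFamily {k : ℕ} (hRic : RicPos n k γ)
    (hnormal : ∀ J ∈ Λ, ∀ t, inner ℝ (J t) (velocity n γ t) = 0) :
    (jacobiFamily hγ hΛ hS).HasPosRicci k := fun t J hJ => by
  rw [← sum_sectionalCurvature_eq_curvatureSum hJ hnormal]
  exact hRic t _ (orthonormal_cons_velocity hγ hJ fun i =>
    mem_normalSpace.2 (hnormal _ (J i).2 t)) _ (mem_chart_source _ _)

lemma isMaximal_jacobiFamily (hdim : Module.finrank ℝ Λ + 1 = n)
    (hnormal : ∀ J ∈ Λ, ∀ t, inner ℝ (J t) (velocity n γ t) = 0) :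
    (jacobiFamily hγ hΛ hS).IsMaximal := fun t J => by
  have := finiteDimensional_of_isJacobiField hγ hΛ
  have hderiv : ∀ J : Λ, covDeriv γ J.1 t ∈ normalSpace γ t := fun J =>
    (hΛ J J.2).isCovDerivAlong_covDeriv.mem_normalSpace hγ (hnormal J J.2) t
  have hvert : (jacobiFamily hγ hΛ hS).vert ⊤ t = normalSpace γ t := by
    refine Submodule.eq_of_le_of_finrank_eq (LagrangianFamily.vert_le
      (fun J _ => mem_normalSpace.2 (hnormal J J.2 t)) fun J _ _ => hderiv J) ?_
    exact (LagrangianFamily.finrank_vert (jacobiFamily hγ hΛ hS) ⊤ t).trans ((finrank_top ℝ Λ).trans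
      (Nat.succ_injective (hdim.trans (finrank_normalSpace hγ t).symm)))
  exact hvert.ge (hderiv J)

end JacobiFamily

section Parallel

variable {n : ℕ} {M : Type*} [TopologicalSpace M] [ChartedSpace (EuclideanSpace ℝ (Fin n)) M]
  [IsManifold (𝓡 n) ∞ M] [Bundle.RiemannianBundle (fun x : M => TangentSpace (𝓡 n) x)]
  [IsContMDiffRiemannianBundle (𝓡 n) ∞ (EuclideanSpace ℝ (Fin n))
    (fun x : M => TangentSpace (𝓡 n) x)]
  {γ : ℝ → M} {Λ : Submodule ℝ (∀ t, TangentSpace (𝓡 n) (γ t))}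
  {hγ : IsUnitSpeedGeodesic n γ} {hΛ : ∀ J ∈ Λ, IsJacobiField γ J}
  {hS : RiccatiSelfAdjoint γ Λ} {W : ∀ t, TangentSpace (𝓡 n) (γ t)} {q : ℝ → Λ}

lemma isCovDerivAlong_hor_zero [FiniteDimensional ℝ Λ] {Z : Submodule ℝ Λ} {J : Λ}
    (hq : ∀ t, J - q t ∈ Z)
    (horth : ∀ t, (jacobiFamily hγ hΛ hS).ev t (q t) ∈ ((jacobiFamily hγ hΛ hS).vert Z t)ᗮ)
    (hdq : ∀ t, covDeriv γ (q t).1 t = 0) :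
    IsCovDerivAlong γ (fun t => (jacobiFamily hγ hΛ hS).hor Z t J) 0 := by
  refine isCovDerivAlong_zero_of_isLittleO hγ.1.continuous fun t₀ =>
    ⟨q t₀, _, (hΛ _ (q t₀).2).isCovDerivAlong_covDeriv, hdq t₀, ?_, ?_⟩
  · exact (LagrangianFamily.hor_eq_of_sub_mem (hq t₀) t₀).trans
      (LagrangianFamily.hor_eq_ev (horth t₀))
  · refine (LagrangianFamily.isLittleO_norm_starProjection_ev (horth t₀) (hdq t₀)).congr_left
      fun t => ?_
    rw [LagrangianFamily.hor_eq_of_sub_mem (hq t₀), LagrangianFamily.hor_apply,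
      Submodule.starProjection_orthogonal_val, ← norm_neg]
    congr 1
    exact (sub_sub_cancel_left _ _).symm

lemma inner_covDeriv_covDeriv_eq_zero (hW : IsCovDerivAlong γ W 0) (hγ : IsUnitSpeedGeodesic n γ)
    (hΛ : ∀ J ∈ Λ, IsJacobiField γ J) (hS : RiccatiSelfAdjoint γ Λ)
    (hq : ∀ t, (q t).1 t = W t) (hdq : ∀ t, covDeriv γ (q t).1 t = 0) (J : Λ) (t : ℝ) :
    inner ℝ (W t) (covDeriv γ (covDeriv γ J.1) t) = 0 := by
  have horth : ∀ t, inner ℝ (W t) (covDeriv γ J.1 t) = 0 := fun t => by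
    have hsymm := (jacobiFamily hγ hΛ hS).symm (q t) J t
    rw [show (jacobiFamily hγ hΛ hS).dv t (q t) = 0 from hdq t, inner_zero_left] at hsymm
    rw [← hq t]
    exact hsymm.symm
  have hderiv := hW.hasDerivAt_inner hγ.1 (hΛ J J.2).isCovDerivAlong_covDeriv_covDeriv t
  simp only [horth] at hderiv
  simpa using hderiv.unique (hasDerivAt_const t (0 : ℝ))

lemma range_ev_jacobiFamily {t : ℝ} (hdim : Module.finrank ℝ Λ + 1 = n)
    (hnormal : ∀ J ∈ Λ, ∀ t, inner ℝ (J t) (velocity n γ t) = 0)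
    (hinj : Function.Injective ((jacobiFamily hγ hΛ hS).ev t)) :
    LinearMap.range ((jacobiFamily hγ hΛ hS).ev t) = normalSpace γ t := by
  refine Submodule.eq_of_le_of_finrank_eq ?_ ?_
  · rintro _ ⟨J, rfl⟩
    exact mem_normalSpace.2 (hnormal J J.2 t)
  · exact (LinearMap.finrank_range_of_inj hinj).trans
      (Nat.succ_injective (hdim.trans (finrank_normalSpace hγ t).symm))

lemma curvature_eq_zero_of_injective (hγ : IsUnitSpeedGeodesic n γ)
    (hΛ : ∀ J ∈ Λ, IsJacobiField γ J) (hS : RiccatiSelfAdjoint γ Λ)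
    (hdim : Module.finrank ℝ Λ + 1 = n)
    (hnormal : ∀ J ∈ Λ, ∀ t, inner ℝ (J t) (velocity n γ t) = 0)
    (hW : IsCovDerivAlong γ W 0) (hq : ∀ t, (q t).1 t = W t)
    (hdq : ∀ t, covDeriv γ (q t).1 t = 0) {t : ℝ}
    (hinj : Function.Injective ((jacobiFamily hγ hΛ hS).ev t)) {x₀ : M}
    (ht : γ t ∈ (chartAt (EuclideanSpace ℝ (Fin n)) x₀).source) :
    curvature x₀ (γ t) (W t) (velocity n γ t) (velocity n γ t) = 0 := by
  let F := jacobiFamily hγ hΛ hS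
  have hF : ∀ J : Λ, covDeriv γ (covDeriv γ J.1) t = -F.R t (F.ev t J) := fun J =>
    (hΛ J J.2).covDeriv_covDeriv (mem_chart_source _ (γ t))
  have hmem : covDeriv γ (covDeriv γ (q t).1) t ∈ LinearMap.range (F.ev t) := by
    rw [range_ev_jacobiFamily hdim hnormal hinj]
    exact (hΛ _ (q t).2).isCovDerivAlong_covDeriv_covDeriv.mem_normalSpace hγ (fun s =>
      mem_normalSpace.1 ((hΛ _ (q t).2).isCovDerivAlong_covDeriv.mem_normalSpace hγ
        (hnormal _ (q t).2) s)) t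
  obtain ⟨J, hJ⟩ := hmem
  have hnorm : inner ℝ (F.R t (F.ev t (q t))) (F.ev t J) = 0 := by
    have horth := inner_covDeriv_covDeriv_eq_zero hW hγ hΛ hS hq hdq J t
    rw [hF, ← hq, inner_neg_right, neg_eq_zero] at horth
    rw [F.inner_R_comm]
    exact horth
  rw [hJ, hF, inner_neg_right, neg_eq_zero, inner_self_eq_zero] at hnorm
  rw [← hq, ← neg_eq_zero, ← (hΛ _ (q t).2).covDeriv_covDeriv ht, hF, hnorm, neg_zero]

lemma eq_of_isCovDerivAlong_zero (hγ : IsUnitSpeedGeodesic n γ)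
    (hΛ : ∀ J ∈ Λ, IsJacobiField γ J) (hS : RiccatiSelfAdjoint γ Λ)
    (hdim : Module.finrank ℝ Λ + 1 = n)
    (hnormal : ∀ J ∈ Λ, ∀ t, inner ℝ (J t) (velocity n γ t) = 0)
    (hW : IsCovDerivAlong γ W 0) (hq : ∀ t, (q t).1 t = W t)
    (hdq : ∀ t, covDeriv γ (q t).1 t = 0) (t₀ : ℝ) : W = q t₀ := by
  have := finiteDimensional_of_isJacobiField hγ hΛ
  have hWJacobi : IsJacobiField γ W := by
    refine ⟨0, 0, hW, isCovDerivAlong_zero_zero γ, fun x₀ t ht =>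
      (zero_add _).trans (curvature_eq_zero_of_eventually hγ ht hW ?_)⟩
    filter_upwards [(jacobiFamily hγ hΛ hS).eventually_ev_injective t, nhdsWithin_le_nhds
      (eventually_mem_chart_source hγ.1.continuous.continuousAt ht)] with s hinj hs
    exact curvature_eq_zero_of_injective hγ hΛ hS hdim hnormal hW hq hdq hinj hs
  have hqJacobi := hΛ _ (q t₀).2
  refine sub_eq_zero.1 ((hWJacobi.sub hqJacobi).eq_zero hγ (t := t₀) ?_ ?_)
  · rw [Pi.sub_apply, hq, sub_self]
  · rw [(hW.sub hqJacobi.isCovDerivAlong_covDeriv).covDeriv_eq, Pi.sub_apply, hdq, sub_zero,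
      Pi.zero_apply]

lemma exists_mem_parallelFields (hdim : Module.finrank ℝ Λ + 1 = n)
    (hnormal : ∀ J ∈ Λ, ∀ t, inner ℝ (J t) (velocity n γ t) = 0) [FiniteDimensional ℝ Λ]
    {Z : Submodule ℝ Λ} {J : Λ} (h : ∀ t, ∃ q, J - q ∈ Z ∧
      (jacobiFamily hγ hΛ hS).ev t q ∈ ((jacobiFamily hγ hΛ hS).vert Z t)ᗮ ∧
      (jacobiFamily hγ hΛ hS).dv t q = 0) :
    ∃ P : Λ, J - P ∈ Z ∧ P.1 ∈ parallelFields γ := by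
  choose q hq horth hdq using h
  have hW := isCovDerivAlong_hor_zero hq horth hdq
  have hWq := eq_of_isCovDerivAlong_zero hγ hΛ hS hdim hnormal hW (fun t =>
    ((LagrangianFamily.hor_eq_of_sub_mem (hq t) t).trans
      (LagrangianFamily.hor_eq_ev (horth t))).symm) hdq 0
  exact ⟨q 0, hq 0, hWq ▸ hW⟩

end Parallel

section VanishingSpan

variable {n : ℕ} {M : Type*} [TopologicalSpace M] [ChartedSpace (EuclideanSpace ℝ (Fin n)) M]
  {γ : ℝ → M} {Λ : Submodule ℝ (∀ t, TangentSpace (𝓡 n) (γ t))}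

lemma vanishingSpan_le (Λ : Submodule ℝ (∀ t, TangentSpace (𝓡 n) (γ t))) :
    vanishingSpan γ Λ ≤ Λ :=
  Submodule.span_le.2 fun _ hJ => hJ.1

lemma finrank_comap_vanishingSpan (Λ : Submodule ℝ (∀ t, TangentSpace (𝓡 n) (γ t))) :
    Module.finrank ℝ ((vanishingSpan γ Λ).comap Λ.subtype) =
      Module.finrank ℝ (vanishingSpan γ Λ) :=
  (Submodule.comapSubtypeEquivOfLe (vanishingSpan_le Λ)).finrank_eq

lemma mem_comap_vanishingSpan {J : Λ} {t : ℝ} (ht : J.1 t = 0) :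
    J ∈ (vanishingSpan γ Λ).comap Λ.subtype :=
  Submodule.subset_span ⟨J.2, t, ht⟩

variable [IsManifold (𝓡 n) ∞ M] [Bundle.RiemannianBundle (fun x : M => TangentSpace (𝓡 n) x)]
  [IsContMDiffRiemannianBundle (𝓡 n) ∞ (EuclideanSpace ℝ (Fin n))
    (fun x : M => TangentSpace (𝓡 n) x)] {P Z : ∀ t, TangentSpace (𝓡 n) (γ t)}

lemma inner_eq_zero_of_mem_vanishingSpan (hγ : ContMDiff 𝓘(ℝ, ℝ) (𝓡 n) ∞ γ)
    (hΛ : ∀ J ∈ Λ, IsJacobiField γ J) (hS : RiccatiSelfAdjoint γ Λ)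
    (hZ : Z ∈ vanishingSpan γ Λ) (hP : P ∈ Λ ⊓ parallelFields γ) (t : ℝ) :
    inner ℝ (Z t) (P t) = 0 := by
  obtain ⟨hPΛ, hP' : IsCovDerivAlong γ P 0⟩ := hP
  induction hZ using Submodule.span_induction with
  | mem J hJ =>
    obtain ⟨hJΛ, s, hs⟩ := hJ
    have hJ' := (hΛ J hJΛ).isCovDerivAlong_covDeriv
    have hderiv : ∀ t, HasDerivAt (fun s => inner ℝ (J s) (P s)) 0 t := fun t => by
      refine (hJ'.hasDerivAt_inner hγ hP' t).congr_deriv ?_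
      rw [hS J hJΛ P hPΛ _ _ hJ' hP' t, Pi.zero_apply, inner_zero_right, add_zero]
    have hconst := is_const_of_deriv_eq_zero (fun t => (hderiv t).differentiableAt)
      (fun t => (hderiv t).deriv) t s
    simpa only [hs, inner_zero_left] using hconst
  | zero => exact inner_zero_left _
  | add J K _ _ hJ hK => rw [Pi.add_apply, inner_add_left, hJ, hK, add_zero]
  | smul c J _ hJ => rw [Pi.smul_apply, real_inner_smul_left, hJ, mul_zero]

lemma disjoint_vanishingSpan_parallelFields (hγ : ContMDiff 𝓘(ℝ, ℝ) (𝓡 n) ∞ γ)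
    (hΛ : ∀ J ∈ Λ, IsJacobiField γ J) (hS : RiccatiSelfAdjoint γ Λ) :
    Disjoint (vanishingSpan γ Λ) (Λ ⊓ parallelFields γ) :=
  Submodule.disjoint_def.2 fun _ hZ hP => funext fun t =>
    (inner_self_eq_zero (𝕜 := ℝ)).1 (inner_eq_zero_of_mem_vanishingSpan hγ hΛ hS hZ hP t)

lemma vanishingSpan_sup_parallelFields {k : ℕ} (hk : 1 ≤ k) (hγ : IsUnitSpeedGeodesic n γ)
    (hRic : RicNonneg n k γ) (hdim : Module.finrank ℝ Λ + 1 = n)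
    (hΛ : ∀ J ∈ Λ, IsJacobiField γ J)
    (hnormal : ∀ J ∈ Λ, ∀ t, inner ℝ (J t) (velocity n γ t) = 0)
    (hS : RiccatiSelfAdjoint γ Λ)
    (hZ : Module.finrank ℝ (vanishingSpan γ Λ) + k ≤ Module.finrank ℝ Λ) :
    vanishingSpan γ Λ ⊔ (Λ ⊓ parallelFields γ) = Λ := by
  have := finiteDimensional_of_isJacobiField hγ hΛ
  rw [← finrank_comap_vanishingSpan] at hZ
  refine le_antisymm (sup_le (vanishingSpan_le Λ) inf_le_left) fun J hJ => ?_
  have hsplit := (isMaximal_jacobiFamily (hγ := hγ) (hΛ := hΛ) (hS := hS) hdim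
    hnormal).exists_horizontal_dv_eq_zero hk (hasNonnegRicci_jacobiFamily hRic hnormal)
    (fun _ _ => mem_comap_vanishingSpan) hZ
  obtain ⟨P, hPZ, hP⟩ := exists_mem_parallelFields hdim hnormal fun t => hsplit t ⟨J, hJ⟩
  exact Submodule.mem_sup.2 ⟨J - P.1, hPZ, P.1, ⟨P.2, hP⟩, sub_add_cancel _ _⟩

lemma finrank_lt_finrank_vanishingSpan_add {k : ℕ} (hγ : IsUnitSpeedGeodesic n γ)
    (hRic : RicPos n k γ) (hdim : Module.finrank ℝ Λ + 1 = n)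
    (hΛ : ∀ J ∈ Λ, IsJacobiField γ J)
    (hnormal : ∀ J ∈ Λ, ∀ t, inner ℝ (J t) (velocity n γ t) = 0)
    (hS : RiccatiSelfAdjoint γ Λ) :
    Module.finrank ℝ Λ < Module.finrank ℝ (vanishingSpan γ Λ) + k := by
  have := finiteDimensional_of_isJacobiField hγ hΛ
  rw [← finrank_comap_vanishingSpan]
  exact (isMaximal_jacobiFamily (hγ := hγ) (hΛ := hΛ) (hS := hS) hdim
    hnormal).finrank_lt_of_hasPosRicci (hasPosRicci_jacobiFamily hRic hnormal)
    fun _ _ => mem_comap_vanishingSpan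

end VanishingSpan

end JacobiSplitting

theorem theoremC_general {n : ℕ} {M : Type*} [TopologicalSpace M]
    [ChartedSpace (EuclideanSpace ℝ (Fin n)) M] [IsManifold (𝓡 n) ∞ M]
    [Bundle.RiemannianBundle (fun x : M => TangentSpace (𝓡 n) x)]
    [IsContMDiffRiemannianBundle (𝓡 n) ∞ (EuclideanSpace ℝ (Fin n))
      (fun x : M => TangentSpace (𝓡 n) x)]
    (k : ℕ) (hk : 1 ≤ k)
    (γ : ℝ → M) (hγ : JacobiSplitting.IsUnitSpeedGeodesic n γ)
    (hRic : JacobiSplitting.RicNonneg n k γ)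
    (Λ : Submodule ℝ (∀ t, TangentSpace (𝓡 n) (γ t)))
    (hdim : Module.finrank ℝ Λ + 1 = n)
    (hJacobi : ∀ J ∈ Λ, JacobiSplitting.IsJacobiField γ J)
    (hnormal : ∀ J ∈ Λ, ∀ t, inner ℝ (J t) (JacobiSplitting.velocity n γ t) = 0)
    (hS : JacobiSplitting.RiccatiSelfAdjoint γ Λ) :
    ((Module.finrank ℝ (JacobiSplitting.vanishingSpan γ Λ) : ℤ) ≤ n - k - 1 →
      JacobiSplitting.vanishingSpan γ Λ ⊔ (Λ ⊓ JacobiSplitting.parallelFields γ) = Λ ∧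
      Disjoint (JacobiSplitting.vanishingSpan γ Λ) (Λ ⊓ JacobiSplitting.parallelFields γ) ∧
      ∀ Z ∈ JacobiSplitting.vanishingSpan γ Λ, ∀ P ∈ Λ ⊓ JacobiSplitting.parallelFields γ,
        ∀ t, inner ℝ (Z t) (P t) = 0) ∧
    (JacobiSplitting.RicPos n k γ →
      (n : ℤ) - k ≤ Module.finrank ℝ (JacobiSplitting.vanishingSpan γ Λ)) :=
  ⟨fun hZ =>
    ⟨JacobiSplitting.vanishingSpan_sup_parallelFields hk hγ hRic hdim hJacobi hnormal hS
      (by omega),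
    JacobiSplitting.disjoint_vanishingSpan_parallelFields hγ.1 hJacobi hS,
    fun _ hZ _ hP => JacobiSplitting.inner_eq_zero_of_mem_vanishingSpan hγ.1 hJacobi hS hZ hP⟩,
  fun hpos => by
    have := JacobiSplitting.finrank_lt_finrank_vanishingSpan_add hγ hpos hdim hJacobi hnormal hS
    omega⟩

theorem theoremC {n : ℕ} {M : Type*} [EMetricSpace M]
    [ChartedSpace (EuclideanSpace ℝ (Fin n)) M] [IsManifold (𝓡 n) ∞ M]
    [Bundle.RiemannianBundle (fun x : M => TangentSpace (𝓡 n) x)]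
    [IsContMDiffRiemannianBundle (𝓡 n) ∞ (EuclideanSpace ℝ (Fin n))
      (fun x : M => TangentSpace (𝓡 n) x)]
    [IsRiemannianManifold (𝓡 n) M] [CompleteSpace M]
    (k : ℕ) (hk : 1 ≤ k)
    (γ : ℝ → M) (hγ : JacobiSplitting.IsUnitSpeedGeodesic n γ)
    (hRic : JacobiSplitting.RicNonneg n k γ)
    (Λ : Submodule ℝ (∀ t, TangentSpace (𝓡 n) (γ t)))
    (hdim : Module.finrank ℝ Λ + 1 = n)
    (hJacobi : ∀ J ∈ Λ, JacobiSplitting.IsJacobiField γ J)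
    (hnormal : ∀ J ∈ Λ, ∀ t, inner ℝ (J t) (JacobiSplitting.velocity n γ t) = 0)
    (hS : JacobiSplitting.RiccatiSelfAdjoint γ Λ) :
    ((Module.finrank ℝ (JacobiSplitting.vanishingSpan γ Λ) : ℤ) ≤ n - k - 1 →
      JacobiSplitting.vanishingSpan γ Λ ⊔ (Λ ⊓ JacobiSplitting.parallelFields γ) = Λ ∧
      Disjoint (JacobiSplitting.vanishingSpan γ Λ) (Λ ⊓ JacobiSplitting.parallelFields γ) ∧
      ∀ Z ∈ JacobiSplitting.vanishingSpan γ Λ, ∀ P ∈ Λ ⊓ JacobiSplitting.parallelFields γ,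
        ∀ t, inner ℝ (Z t) (P t) = 0) ∧
    (JacobiSplitting.RicPos n k γ →
      (n : ℤ) - k ≤ Module.finrank ℝ (JacobiSplitting.vanishingSpan γ Λ)) :=
  theoremC_general k hk γ hγ hRic Λ hdim hJacobi hnormal hS
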